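/- Let $T$ be a compact metric space and let $\mathbb{C}_0$ be the space of non-negative, not identically zero continuous functions $f:T\to\mathbb{R}$, with the topology of the sup norm $\|\cdot\|$ and its Borel $\sigma$-algebra. Let $M_p(\mathbb{C}_0)$ be the space of point measures $M=\sum_{i\in I}\delta_{f_i}$ on $\mathbb{C}_0$ such that $\{i\in I:\|f_i\|>\varepsilon\}$ is finite for every $\varepsilon>0$, with the $\sigma$-algebra generated by the maps $M\mapsto M(A)$, $A\subset\mathbb{C}_0$ Borel; write $[M]$ for the set of atoms of $M$ and $\max(M)(s)=\max\{f(s):f\in[M]\}$ (equal to $0$ if $M=0$). Let $\mu$ be a Borel measure on $\mathbb{C}_0$ with $\mu(\{f:\|f\|>\varepsilon\})<\infty$ for all $\varepsilon>0$, let $\Phi$ be an $M_p(\mathbb{C}_0)$-valued Poisson random measure with intensity $\mu$ on a probability space $(\Omega,\mathcal{F},\mathbb{P})$, and let $\eta=\max(\Phi)$, which is a random continuous function on $T$. For $t\in T$ let $\Phi_{\{t\}}^+$ and $\Phi_{\{t\}}^-$ be the restrictions of $\Phi$ to $\{f: f(t)\ge\eta(t)\}$ and to $\{f: f(t)<\eta(t)\}$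 respectively. Let $\mu_t(A)=\mu(\{f:f(t)\in A\})$ for Borel $A\subset(0,\infty)$ and $\bar\mu_t(x)=\mu_t([x,\infty))$ for $x>0$. Let $P_t(y,df)$, $y>0$, be a regular version of the conditional measure $\mu(df)$ given $f(t)=y$, i.e. a probability kernel such that for every measurable $F:[0,\infty)\times\mathbb{C}_0\to[0,\infty]$ vanishing on $\{0\}\times\mathbb{C}_0$, $$\int_{\mathbb{C}_0}F(f(t),f)\,\mu(df)=\int_{(0,\infty)}\int_{\mathbb{C}_0}F(y,f)\,P_t(y,df)\,\mu_t(dy).$$ Suppose that one of the following (equivalent) conditions holds: (i) $\Phi_{\{t\}}^+(\mathbb{C}_0)=1$ almost surely; (ii) $\bar\mu_t(0^+)=+\infty$ and $\bar\mu_t$ is continuous on $(0,\infty)$; (iii) the distribution of $\eta(t)$ has no atom. Then there is a $\mathbb{C}_0$-valued random variable $\phi_t^+$ with $\Phi_{\{t\}}^+=\delta_{\phi_t^+}$ almost surely. For any such $\phi_t^+$, conditionally on $\eta(t)=y$, the random elements $\phi_t^+$ and $\Phi_{\{t\}}^-$ are independent, $\phi_t^+$ has distribution $P_t(y,\cdot)$,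 and $\Phi_{\{t\}}^-$ has the distribution of a Poisson random measure with intensity $1_{\{f(t)<y\}}\mu(df)$; that is, if $R_t(y,\cdot)$ denotes the latter distribution, the kernel $y\mapsto P_t(y,\cdot)\otimes R_t(y,\cdot)$ is a regular conditional distribution of $(\phi_t^+,\Phi_{\{t\}}^-)$ given $\eta(t)=y$. Furthermore, for the regular conditional distribution of $\eta$ given $\eta(t)$ and for almost every $y$ with respect to the distribution of $\eta(t)$, one has, for all $l\ge1$, ${\bf s}=(s_1,\dots,s_l)\in T^l$ and ${\bf z}=(z_1,\dots,z_l)\in[0,\infty)^l$, $$\mathbb{P}[\eta({\bf s})<{\bf z}\mid\eta(t)=y]=P_t(y,\{f({\bf s})<{\bf z}\})\,\exp\big[-\mu(\{f({\bf s})\not<{\bf z},\ f(t)<y\})\big],$$ where $f({\bf s})<{\bf z}$ means $f(s_i)<z_i$ for all $i$, $f({\bf s})\not<{\bf z}$ is its negation, and $\exp[-\infty]=0$. -/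

import Mathlib

open MeasureTheory ProbabilityTheory Set Filter Topology
open scoped ENNReal NNReal

noncomputable section

namespace MaxID

/-- `C(T, ℝ)` carries its Borel σ-algebra. -/
instance instMeasurableSpaceContinuousMap {T : Type*} [TopologicalSpace T] :
    MeasurableSpace C(T, ℝ) := borel _

instance instBorelSpaceContinuousMap {T : Type*} [TopologicalSpace T] :
    BorelSpace C(T, ℝ) := ⟨rfl⟩

instance instStandardBorelSpaceContinuousMap {T : Type*} [MetricSpace T] [CompactSpace T] :
    StandardBorelSpace C(T, ℝ) := by
  have : SecondCountableTopology T := inferInstance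
  infer_instance

/-- The space of non-negative and non-null continuous functions on `T`, with the topology and
the Borel σ-algebra inherited from `C(T, ℝ)`. -/
abbrev C0 (T : Type*) [TopologicalSpace T] : Type _ :=
  {f : C(T, ℝ) // (∀ s, 0 ≤ f s) ∧ f ≠ 0}

section PointMeasures

variable {T : Type*} [MetricSpace T] [CompactSpace T]

/-- Point measures `∑ i ∈ I, δ_{f i}` on `C0 T` (multiplicities are allowed), having only
finitely many points of norm greater than `ε`, for every `ε > 0`. -/
def IsPointMeasure (M : Measure (C0 T)) : Prop :=
  ∃ (I : Type) (_ : Countable I) (f : I → C0 T),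
    M = Measure.sum (fun i => Measure.dirac (f i)) ∧
    ∀ ε : ℝ, 0 < ε → {i | ε < ‖(f i).1‖}.Finite

variable (T) in
/-- The space of point measures on `C0 T`. -/
def PointMeasure : Type _ := {M : Measure (C0 T) // IsPointMeasure M}

/-- The σ-algebra generated by the evaluations `M ↦ M A`, `A` Borel: the trace of the
σ-algebra of Mathlib on `Measure (C0 T)`, which is generated by these evaluations. -/
instance instMeasurableSpacePointMeasure : MeasurableSpace (PointMeasure T) :=
  inferInstanceAs (MeasurableSpace {M : Measure (C0 T) // IsPointMeasure M})

theorem IsPointMeasure.restrict {M : Measure (C0 T)} (hM : IsPointMeasure M)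
    (S : Set (C0 T)) : IsPointMeasure (M.restrict S) := by
  classical
  obtain ⟨I, hI, f, rfl, hf⟩ := hM
  refine ⟨{i : I // f i ∈ S}, inferInstance, fun i => f i.1, ?_, fun ε hε => ?_⟩
  · rw [Measure.restrict_sum_of_countable]
    ext A hA
    rw [Measure.sum_apply _ hA, Measure.sum_apply _ hA]
    have h := tsum_subtype {i : I | f i ∈ S} (fun i => Measure.dirac (f i) A)
    refine Eq.trans ?_ h.symm
    refine tsum_congr fun i => ?_
    rw [MeasureTheory.restrict_dirac]
    by_cases hi : f i ∈ S <;> simp [hi, Set.indicator]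
  · exact Set.Finite.preimage (s := {i : I | ε < ‖(f i).1‖})
      (f := fun i : {i : I // f i ∈ S} => i.1) Subtype.val_injective.injOn (hf ε hε)

/-- The set `[M]` of atoms of a point measure. -/
def PointMeasure.atoms (M : PointMeasure T) : Set (C0 T) := {f | M.1 {f} ≠ 0}

/-- The pointwise maximum `max(M)(s) = max {f s ; f ∈ [M]}`; it is `0` if `M = 0`. -/
def PointMeasure.max (M : PointMeasure T) (s : T) : ℝ := ⨆ f : M.atoms, f.1.1 s

/-- The functions `f` with `f <_K max(M)`. -/
def PointMeasure.below (K : Set T) (M : PointMeasure T) : Set (C0 T) :=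
  {f | ∀ s ∈ K, f.1 s < M.max s}

/-- The `K`-sub-extremal point measure: the points `f` of `M` with `f <_K max(M)`. -/
def PointMeasure.subExtremal (K : Set T) (M : PointMeasure T) : PointMeasure T :=
  ⟨M.1.restrict (M.below K), M.2.restrict _⟩

/-- The `K`-extremal point measure: the points of `M` without `f <_K max(M)`. -/
def PointMeasure.extremal (K : Set T) (M : PointMeasure T) : PointMeasure T :=
  ⟨M.1.restrict (M.below K)ᶜ, M.2.restrict _⟩

/-- The Poisson law with mean `r ∈ [0, ∞]`; it is the Dirac mass at `∞` if `r = ∞`. -/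
def poissonLaw (r : ℝ≥0∞) : Measure ℝ≥0∞ :=
  open Classical in
  if r = ∞ then Measure.dirac ∞
  else (poissonMeasure r.toNNReal).map (fun n : ℕ => (n : ℝ≥0∞))

/-- `Φ` is a Poisson random measure (Poisson point process) with intensity `μ`. -/
structure IsPoissonRandomMeasure {Ω : Type*} [MeasurableSpace Ω] (Φ : Ω → PointMeasure T)
    (μ : Measure (C0 T)) (P : Measure Ω) : Prop where
  measurable : Measurable Φ
  law : ∀ A : Set (C0 T), MeasurableSet A → P.map (fun ω => (Φ ω).1 A) = poissonLaw (μ A)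
  indep : ∀ (n : ℕ) (A : Fin n → Set (C0 T)), (∀ i, MeasurableSet (A i)) →
    Pairwise (fun i j => Disjoint (A i) (A j)) → iIndepFun (fun i ω => (Φ ω).1 (A i)) P

/-- `R` is the law of a Poisson random measure with intensity `μ`. -/
def IsPoissonRandomMeasureLaw (R : Measure (PointMeasure T)) (μ : Measure (C0 T)) : Prop :=
  IsPoissonRandomMeasure (fun M : PointMeasure T => M) μ R

/-- The measure `μ_t(A) = μ {f ; f t ∈ A}` on `(0, ∞)`, seen as a measure on `ℝ`. -/
def marginal (μ : Measure (C0 T)) (t : T) : Measure ℝ :=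
  (μ.map (fun f : C0 T => f.1 t)).restrict (Ioi 0)

/-- The tail function `x ↦ μ_t [x, ∞)`. -/
def tail (μ : Measure (C0 T)) (t : T) (x : ℝ) : ℝ≥0∞ := marginal μ t (Ici x)

/-- `κ` is a regular version `P_t(x, df)` of the conditional measure `μ(df)` given `f t = x`,
for `x > 0` (the measures `κ x` for `x ≤ 0` are arbitrary probability measures, and the
values `F x f` for `x < 0` are irrelevant). -/
structure IsRegularCondMeasure (μ : Measure (C0 T)) (t : T) (κ : Kernel ℝ (C0 T)) : Prop where
  isMarkov : IsMarkovKernel κ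
  disintegration : ∀ F : ℝ → C0 T → ℝ≥0∞, Measurable (Function.uncurry F) →
    (∀ f, F 0 f = 0) →
    ∫⁻ f, F (f.1 t) f ∂μ = ∫⁻ x, ∫⁻ f, F x f ∂(κ x) ∂(marginal μ t)

end PointMeasures

/-- `κ` is a regular conditional distribution of the random variable `Y` given `X`. -/
structure IsRegularCondDistrib {Ω α β : Type*} [MeasurableSpace Ω] [MeasurableSpace α]
    [MeasurableSpace β] (Y : Ω → β) (X : Ω → α) (P : Measure Ω) (κ : Kernel α β) : Prop where
  measurable_left : Measurable Y
  measurable_right : Measurable X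
  isMarkov : IsMarkovKernel κ
  eq_lintegral : ∀ (A : Set α) (B : Set β), MeasurableSet A → MeasurableSet B →
    P (X ⁻¹' A ∩ Y ⁻¹' B) = ∫⁻ x in A, κ x B ∂(P.map X)

end MaxID

end

/-! The proof rests on the Mecke formula: the expected number of points `f` of `Φ` with `(f, Φ)` in
`D` equals `∫ P((f, Φ + δ_f) ∈ D) μ(df)`. Let `D` say that `f t ∈ A`, that no point exceeds `f` at
`t`, and that `f` together with the points strictly below it at `t` lies in `B`. Once the extremal
point is almost surely unique, the left side is the probability that `η t ∈ A` and that the extremal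
function and the sub-extremal measure lie in `B`. On the right, adding `f` changes neither the
points strictly above the level `f t` nor those strictly below it, and these two families are
independent. The void probability of the first gives `exp(-μ{g t > f t})`, the second follows the
Poisson law `R (f t)`. Disintegrating `μ` along `f t = y` turns the right side into the integral
over `A` of `exp(-μ{g t > y}) (κ ×ₖ R) y B` against the marginal (`prob_extremal`). Taking `B` to be
everything identifies the law of `η t`, so `κ ×ₖ R` is the conditional law.

The process is the pointwise maximum of the extremal function and of the maximum of the sub-extremal
measure. Its conditional law is therefore an image of `κ ×ₖ R`, and the explicit formula is one more
void probability.

The Mecke formula itself (`mecke`) comes from the identity `E[N; N ∈ U] = r P(N + 1 ∈ U)` for a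
Poisson variable. It passes to finite partitions by independence, to all events by a π-system
argument, and to infinite `μ` by cutting along the norm.

Each of the three regularity hypotheses implies `IsRegularAt`, and `IsRegularAt` implies uniqueness
of the extremal point, by the Mecke formula again. -/

noncomputable section

/-! ### Kernels with locally finite mass -/

/-- A kernel is s-finite as soon as there is a countable measurable partition of the target, all
of whose cells have finite (not necessarily uniformly bounded) mass. -/
theorem ProbabilityTheory.Kernel.isSFiniteKernel_of_forall_lt_top {α β : Type*}
    [MeasurableSpace α] [MeasurableSpace β] (κ : Kernel α β) (g : β → ℕ) (hg : Measurable g)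
    (h : ∀ a n, κ a (g ⁻¹' {n}) < ∞) : IsSFiniteKernel κ := by
  classical
  have hS : ∀ n, MeasurableSet (g ⁻¹' {n}) := fun n => hg (measurableSet_singleton n)
  -- The mass of a cell is finite for each parameter but may be unbounded over the parameters.
  -- Slicing the parameters by its integer part `k` gives the uniform bound `k + 1` on each slice.
  have hE : ∀ n k, MeasurableSet {a | ⌊(κ a (g ⁻¹' {n})).toNNReal⌋₊ = k} := fun n k =>
    (Nat.measurable_floor.comp
      (Kernel.measurable_coe κ (hS n)).ennreal_toNNReal) (measurableSet_singleton k)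
  set K : ℕ × ℕ → Kernel α β := fun p =>
    Kernel.piecewise (hE p.1 p.2) (κ.restrict (hS p.1)) 0 with hK
  have hfin : ∀ p, IsFiniteKernel (K p) := by
    rintro ⟨n, k⟩
    refine ⟨⟨k + 1, by finiteness, fun a => ?_⟩⟩
    simp only [hK, Kernel.piecewise_apply']
    split_ifs with ha
    · rw [Kernel.restrict_apply, Measure.restrict_apply_univ]
      have := (Nat.lt_floor_add_one (κ a (g ⁻¹' {n})).toNNReal).le
      rw [show ⌊(κ a (g ⁻¹' {n})).toNNReal⌋₊ = k from ha] at this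
      rw [← ENNReal.coe_toNNReal (h a n).ne]
      exact_mod_cast this
    · simp
  have : κ = Kernel.sum K := by
    ext a A hA
    rw [Kernel.sum_apply' _ _ hA, ENNReal.tsum_prod']
    have : ∀ n, ∑' k, K (n, k) a A = κ a (A ∩ g ⁻¹' {n}) := by
      intro n
      rw [tsum_eq_single ⌊(κ a (g ⁻¹' {n})).toNNReal⌋₊]
      · simp only [hK, Kernel.piecewise_apply']
        rw [if_pos (by simp), Kernel.restrict_apply, Measure.restrict_apply hA]
      · intro k hk
        simp only [hK, Kernel.piecewise_apply']
        rw [if_neg (by simpa using hk.symm)]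
        simp
    simp_rw [this]
    rw [← measure_iUnion]
    · congr 1
      ext x; simp
    · intro i j hij
      refine Set.disjoint_left.2 fun x hx hy => hij ?_
      rw [← hx.2, ← hy.2]
    · exact fun n => hA.inter (hS n)
  rw [this]
  infer_instance

namespace MaxID

/-! ### The Poisson law on `[0, ∞]` -/

section Poisson

instance isProbabilityMeasure_poissonLaw (r : ℝ≥0∞) : IsProbabilityMeasure (poissonLaw r) := by
  unfold poissonLaw
  split_ifs
  · infer_instance
  · exact Measure.isProbabilityMeasure_map Measurable.of_discrete.aemeasurable

theorem poissonLaw_of_ne_top {r : ℝ≥0∞} (hr : r ≠ ∞) :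
    poissonLaw r = (poissonMeasure r.toNNReal).map (fun n : ℕ => (n : ℝ≥0∞)) := by
  simp [poissonLaw, hr]

theorem poissonLaw_top : poissonLaw ∞ = Measure.dirac ∞ := by simp [poissonLaw]

theorem poissonLaw_natCast {r : ℝ≥0∞} (hr : r ≠ ∞) (n : ℕ) :
    poissonLaw r {(n : ℝ≥0∞)} =
      ENNReal.ofReal (Real.exp (-r.toReal) * r.toReal ^ n / n.factorial) := by
  rw [poissonLaw_of_ne_top hr,
    Measure.map_apply Measurable.of_discrete (measurableSet_singleton _)]
  have : (fun n : ℕ => (n : ℝ≥0∞)) ⁻¹' {(n : ℝ≥0∞)} = {n} := by ext; simp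
  rw [this, poissonMeasure_singleton]
  rfl

theorem poissonLaw_zero (r : ℝ≥0∞) : poissonLaw r {0} = EReal.exp (-(r : EReal)) := by
  by_cases hr : r = ∞
  · subst hr
    rw [poissonLaw_top]
    simp
  · have := poissonLaw_natCast hr 0
    rw [Nat.cast_zero] at this
    rw [this]
    lift r to ℝ≥0 using hr
    simp only [ENNReal.coe_toReal, pow_zero, Nat.factorial_zero, Nat.cast_one, mul_one, div_one]
    rfl

/-- A finite parameter leaves mass `exp(-r) > 0` at `0`, and an infinite one puts all the mass at
`∞`. This excludes a region that almost surely contains exactly one point. -/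
theorem poissonLaw_one_ne (r : ℝ≥0∞) : poissonLaw r {1} ≠ 1 := by
  intro h
  by_cases hr : r = ∞
  · subst hr
    rw [poissonLaw_top] at h
    simp at h
  · have h0 : poissonLaw r {0} = 0 := by
      refine measure_mono_null (t := {1}ᶜ) (by simp) ?_
      rwa [prob_compl_eq_zero_iff (measurableSet_singleton _)]
    have := poissonLaw_natCast hr 0
    rw [Nat.cast_zero, h0] at this
    simp at this
    exact absurd this (not_le.2 (Real.exp_pos _))

theorem eq_zero_of_poissonLaw_Ici_two {r : ℝ≥0∞} (hr : r ≠ ∞) (h : poissonLaw r (Ici 2) = 0) :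
    r = 0 := by
  by_contra h0
  have h1 : poissonLaw r {((2 : ℕ) : ℝ≥0∞)} = 0 := measure_mono_null (by simp) h
  rw [poissonLaw_natCast hr, ENNReal.ofReal_eq_zero] at h1
  have : 0 < r.toReal := ENNReal.toReal_pos h0 hr
  have : 0 < Real.exp (-r.toReal) * r.toReal ^ 2 / (Nat.factorial 2 : ℝ) := by positivity
  linarith

/-- Since `n rⁿ / n! = r rⁿ⁻¹ / (n-1)!`, weighting a Poisson variable by its value amounts, up to
the factor `r`, to adding one to it. This is the one-cell case of the Mecke formula. -/
theorem setLIntegral_poissonLaw {r : ℝ≥0∞} (hr : r ≠ ∞) {U : Set ℝ≥0∞} (hU : MeasurableSet U) :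
    ∫⁻ x in U, x ∂(poissonLaw r) = r * poissonLaw r ((fun x => x + 1) ⁻¹' U) := by
  classical
  have hU' : MeasurableSet ((fun x : ℝ≥0∞ => x + 1) ⁻¹' U) := measurable_add_const 1 hU
  rw [← lintegral_indicator hU, ← lintegral_indicator_one hU', poissonLaw_of_ne_top hr,
    lintegral_map (f := U.indicator fun x => x) (measurable_id.indicator hU) Measurable.of_discrete,
    lintegral_map (measurable_one.indicator hU') Measurable.of_discrete,
    poissonMeasure, lintegral_sum_measure, lintegral_sum_measure]
  simp only [lintegral_smul_measure, lintegral_dirac, smul_eq_mul]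
  rw [← ENNReal.tsum_mul_left, tsum_eq_zero_add' (M := ℝ≥0∞) ENNReal.summable]
  simp only [Nat.cast_zero, indicator_apply, mem_preimage, ite_self, mul_zero, zero_add,
    Nat.cast_add, Nat.cast_one, Pi.one_apply]
  refine tsum_congr fun n => ?_
  split_ifs with hn
  · lift r to ℝ≥0 using hr
    rw [mul_one, show (r : ℝ≥0∞) = ENNReal.ofReal (r : ℝ) by simp,
      show (n : ℝ≥0∞) + 1 = ENNReal.ofReal (n + 1) by
        rw [ENNReal.ofReal_add (by positivity) zero_le_one]; simp,
      ← ENNReal.ofReal_mul (by positivity), ← ENNReal.ofReal_mul (by positivity)]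
    congr 1
    simp only [ENNReal.ofReal_coe_nnreal, ENNReal.toNNReal_coe]
    rw [Nat.factorial_succ]
    push_cast
    field_simp
    ring
  · simp

end Poisson

/-! ### Measurability on `C0 T` and integrality of point measures -/

section PointMeasures

variable {T : Type*} [MetricSpace T] [CompactSpace T]

omit [CompactSpace T] in
theorem measurable_eval (t : T) : Measurable fun g : C(T, ℝ) => g t :=
  (continuous_eval_const t).measurable

theorem measurable_C0_eval (t : T) : Measurable fun f : C0 T => f.1 t :=
  (measurable_eval t).comp measurable_subtype_coe

theorem measurable_C0_norm : Measurable fun f : C0 T => ‖f.1‖ :=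
  continuous_norm.measurable.comp measurable_subtype_coe

/-- The Borel σ-algebra of `C(T, ℝ)` is generated by the evaluations. -/
theorem measurable_of_eval {α : Type*} [MeasurableSpace α] {h : α → C(T, ℝ)}
    (hh : ∀ s, Measurable fun a => h a s) : Measurable h := by
  obtain ⟨D, hD, hD'⟩ := TopologicalSpace.exists_countable_dense T
  have : Countable D := hD.to_subtype
  -- Restriction to a countable dense set is injective and measurable between standard Borel spaces,
  -- hence a measurable embedding by the Lusin–Souslin theorem.
  have he : MeasurableEmbedding (fun (g : C(T, ℝ)) (d : D) => g d) := by
    refine Measurable.measurableEmbedding (measurable_pi_lambda _ fun d => measurable_eval _) ?_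
    intro g g' hgg
    refine ContinuousMap.coe_injective (Continuous.ext_on hD' g.continuous g'.continuous ?_)
    intro d hd
    exact congrFun hgg ⟨d, hd⟩
  rw [← he.measurable_comp_iff]
  exact measurable_pi_lambda _ fun d => hh d

theorem C0.norm_pos (f : C0 T) : 0 < ‖f.1‖ := norm_pos_iff.2 f.2.2

theorem C0.eval_le_norm (f : C0 T) (s : T) : f.1 s ≤ ‖f.1‖ :=
  (le_abs_self _).trans (f.1.norm_coe_le_norm s)

/-- The integer part of `1 / ‖f‖`: its fibres are norm shells away from `0`. -/
def shell (f : C0 T) : ℕ := ⌊‖f.1‖⁻¹⌋₊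

theorem measurable_shell : Measurable (shell (T := T)) :=
  Nat.measurable_floor.comp measurable_C0_norm.inv

theorem shell_subset (n : ℕ) :
    shell ⁻¹' {n} ⊆ {f : C0 T | (1 / (n + 1) : ℝ) < ‖f.1‖} := by
  intro f hf
  have h1 : ‖f.1‖⁻¹ < n + 1 := by
    have := Nat.lt_floor_add_one (‖f.1‖⁻¹)
    have h2 : ⌊‖f.1‖⁻¹⌋₊ = n := hf
    rwa [h2] at this
  rw [mem_ofPred_eq, one_div]
  exact inv_lt_of_inv_lt₀ f.norm_pos h1

theorem sigmaFinite_of_norm {μ : Measure (C0 T)}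
    (hμ : ∀ ε : ℝ, 0 < ε → μ {f : C0 T | ε < ‖f.1‖} < ∞) : SigmaFinite μ := by
  refine ⟨⟨⟨fun n => shell ⁻¹' {n}, fun _ => trivial, fun n => ?_, ?_⟩⟩⟩
  · exact (measure_mono (shell_subset n)).trans_lt (hμ _ (by positivity))
  · ext; simp

namespace PointMeasure

theorem norm_gt_lt_top (M : PointMeasure T) {ε : ℝ} (hε : 0 < ε) :
    M.1 {f : C0 T | ε < ‖f.1‖} < ∞ := by
  obtain ⟨M, I, hI, f, rfl, hf⟩ := M
  have hm : MeasurableSet {f : C0 T | ε < ‖f.1‖} := measurable_C0_norm measurableSet_Ioi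
  simp only
  rw [Measure.sum_apply _ hm]
  rw [tsum_eq_sum (s := (hf ε hε).toFinset)]
  · refine ENNReal.sum_lt_top.2 fun i _ => ?_
    exact measure_lt_top _ _
  · intro i hi
    have : f i ∉ {f : C0 T | ε < ‖f.1‖} := by simpa using hi
    simp [hm, this]

theorem measurable_apply {A : Set (C0 T)} (hA : MeasurableSet A) :
    Measurable fun M : PointMeasure T => M.1 A :=
  (Measure.measurable_coe hA).comp measurable_subtype_coe

theorem measurable_of_apply {α : Type*} [MeasurableSpace α] {h : α → PointMeasure T}
    (hh : ∀ A, MeasurableSet A → Measurable fun a => (h a).1 A) : Measurable h :=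
  (Measure.measurable_of_measurable_coe _ hh).subtype_mk

theorem exists_rep (M : PointMeasure T) : ∃ (I : Type) (_ : Countable I) (f : I → C0 T),
    (∀ A, MeasurableSet A → M.1 A = ∑' i, A.indicator 1 (f i)) ∧
    ∀ ε : ℝ, 0 < ε → {i | ε < ‖(f i).1‖}.Finite := by
  obtain ⟨M, I, hI, f, rfl, hf⟩ := M
  refine ⟨I, hI, f, fun A hA => ?_, hf⟩
  simp [Measure.sum_apply _ hA, hA]

/-- A point measure takes integer values. -/
theorem apply_mem (M : PointMeasure T) {A : Set (C0 T)} (hA : MeasurableSet A) :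
    ∃ n : ℕ∞, M.1 A = n := by
  obtain ⟨I, hI, f, h, -⟩ := M.exists_rep
  refine ⟨{i | f i ∈ A}.encard, ?_⟩
  have := tsum_subtype {i : I | f i ∈ A} (fun _ => (1 : ℝ≥0∞))
  rw [ENNReal.tsum_set_one] at this
  rw [h A hA, this]
  rfl

theorem one_le_of_ne_zero (M : PointMeasure T) {A : Set (C0 T)} (hA : MeasurableSet A)
    (h : M.1 A ≠ 0) : 1 ≤ M.1 A := by
  obtain ⟨n, hn⟩ := M.apply_mem hA
  rw [hn] at h ⊢
  have : 1 ≤ n := Order.one_le_iff_ne_zero.2 (by rintro rfl; simp at h)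
  exact_mod_cast this

theorem two_le_of_one_lt (M : PointMeasure T) {A : Set (C0 T)} (hA : MeasurableSet A)
    (h : 1 < M.1 A) : 2 ≤ M.1 A := by
  obtain ⟨n, hn⟩ := M.apply_mem hA
  rw [hn] at h ⊢
  have h1 : 1 < n := by exact_mod_cast h
  have : 2 ≤ n := by simpa [one_add_one_eq_two] using Order.add_one_le_of_lt h1
  exact_mod_cast this

theorem exists_atom (M : PointMeasure T) {A : Set (C0 T)} (hA : MeasurableSet A)
    (h : M.1 A ≠ 0) : ∃ f ∈ M.atoms, f ∈ A := by
  obtain ⟨I, hI, f, hf, -⟩ := M.exists_rep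
  rw [hf A hA] at h
  obtain ⟨i, hi⟩ : ∃ i, A.indicator (1 : C0 T → ℝ≥0∞) (f i) ≠ 0 := by
    by_contra! hc
    simp [hc] at h
  refine ⟨f i, ?_, by by_contra hc; simp [hc] at hi⟩
  change M.1 {f i} ≠ 0
  rw [hf _ (measurableSet_singleton _)]
  intro hc
  simpa using ENNReal.tsum_eq_zero.1 hc i

theorem apply_ne_zero_of_atom (M : PointMeasure T) {A : Set (C0 T)} {f : C0 T}
    (hf : f ∈ M.atoms) (hfA : f ∈ A) : M.1 A ≠ 0 := fun h =>
  hf (measure_mono_null (singleton_subset_iff.2 hfA) h)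

/-- By integrality an atom has mass at least `1`, so it exhausts the total mass. -/
theorem eq_dirac_of_univ (M : PointMeasure T) (h : M.1 univ = 1) :
    ∃ f, M.1 = Measure.dirac f := by
  obtain ⟨f, hf, -⟩ := M.exists_atom MeasurableSet.univ (by rw [h]; simp)
  have h1 : 1 ≤ M.1 {f} := M.one_le_of_ne_zero (measurableSet_singleton _) hf
  have h2 : M.1 {f}ᶜ = 0 := by
    have hadd := measure_add_measure_compl (μ := M.1) (measurableSet_singleton f)
    rw [h] at hadd
    have h3 : M.1 {f} = 1 := le_antisymm (hadd ▸ le_self_add) h1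
    rw [h3] at hadd
    exact (ENNReal.add_right_inj ENNReal.one_ne_top).1 (hadd.trans (add_zero 1).symm)
  refine ⟨f, ?_⟩
  ext A hA
  by_cases hfA : f ∈ A
  · rw [Measure.dirac_apply_of_mem hfA]
    refine le_antisymm (h ▸ measure_mono (subset_univ _)) ?_
    exact h1.trans (measure_mono (singleton_subset_iff.2 hfA))
  · rw [Measure.dirac_apply' _ hA, indicator_of_notMem hfA]
    exact measure_mono_null (fun g hg => by rintro rfl; exact hfA hg) h2

variable (T) in
/-- The identity, as a kernel from point measures to functions. -/
def kernel : Kernel (PointMeasure T) (C0 T) := ⟨Subtype.val, measurable_subtype_coe⟩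

instance : IsSFiniteKernel (kernel T) :=
  Kernel.isSFiniteKernel_of_forall_lt_top _ shell measurable_shell fun M n =>
    (measure_mono (shell_subset n)).trans_lt (M.norm_gt_lt_top (by positivity))

/-- The random sets occurring below depend on the point measure itself, through its maximum.
S-finiteness of `kernel T` makes the mass of such a moving section measurable. -/
theorem measurable_section {α : Type*} [MeasurableSpace α] {E : Set (α × C0 T)}
    (hE : MeasurableSet E) {h : α → PointMeasure T} (hh : Measurable h) :
    Measurable fun a => (h a).1 {f | (a, f) ∈ E} := by
  have := Kernel.measurable_kernel_prodMk_left (κ := (kernel T).comap h hh) hE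
  exact this

/-- Adding a point to a point measure. -/
def addDirac (M : PointMeasure T) (f : C0 T) : PointMeasure T :=
  ⟨M.1 + Measure.dirac f, by
    obtain ⟨M, I, hI, g, rfl, hg⟩ := M
    refine ⟨Option I, inferInstance, fun o => o.elim f g, ?_, fun ε hε => ?_⟩
    · ext A hA
      rw [Measure.coe_add, Pi.add_apply, Measure.sum_apply _ hA, Measure.sum_apply _ hA,
        ← (Equiv.optionEquivSumPUnit.{0} I).symm.tsum_eq, ENNReal.summable.tsum_sum ENNReal.summable]
      simp
    · refine ((hg ε hε).image some |>.insert none).subset ?_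
      rintro (_ | i) hi
      · simp
      · exact Or.inr ⟨i, hi, rfl⟩⟩

theorem addDirac_val (M : PointMeasure T) (f : C0 T) :
    (M.addDirac f).1 = M.1 + Measure.dirac f := rfl

theorem measurable_addDirac :
    Measurable fun p : C0 T × PointMeasure T => p.2.addDirac p.1 := by
  refine measurable_of_apply fun A hA => ?_
  simp only [addDirac_val, Measure.coe_add, Pi.add_apply, Measure.dirac_apply' _ hA]
  exact ((measurable_apply hA).comp measurable_snd).add
    ((measurable_one.indicator hA).comp measurable_fst)

/-- The restriction of a point measure to a set. -/
def restrict (M : PointMeasure T) (S : Set (C0 T)) : PointMeasure T :=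
  ⟨M.1.restrict S, M.2.restrict S⟩

theorem restrict_apply (M : PointMeasure T) {S A : Set (C0 T)} (hA : MeasurableSet A) :
    (M.restrict S).1 A = M.1 (A ∩ S) := Measure.restrict_apply hA

theorem measurable_restrict_section {α : Type*} [MeasurableSpace α] {E : Set (α × C0 T)}
    (hE : MeasurableSet E) {h : α → PointMeasure T} (hh : Measurable h) :
    Measurable fun a => (h a).restrict {f | (a, f) ∈ E} := by
  refine measurable_of_apply fun A hA => ?_
  simp only [restrict_apply _ hA]
  convert measurable_section (E := (univ ×ˢ A) ∩ E) ((MeasurableSet.univ.prod hA).inter hE) hh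
    using 3
  ext; simp

theorem measurable_restrict {S : Set (C0 T)} (hS : MeasurableSet S) :
    Measurable fun M : PointMeasure T => M.restrict S := by
  refine measurable_of_apply fun A hA => ?_
  simp only [restrict_apply _ hA]
  exact measurable_apply (hA.inter hS)

end PointMeasure

end PointMeasures

end MaxID

/-! ### Independence of coordinates and cylinder events -/

theorem ProbabilityTheory.iIndepFun.indepFun_update_zero {Ω ι : Type*} [MeasurableSpace Ω]
    [Fintype ι] [DecidableEq ι] {P : Measure Ω} {X : ι → Ω → ℝ≥0∞} (h : iIndepFun X P)
    (hX : ∀ i, Measurable (X i)) (b : ι) :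
    IndepFun (X b) (fun ω => Function.update (fun i => X i ω) b 0) P := by
  have h1 := h.indepFun_finset {b} ((Finset.univ : Finset ι).erase b) (by simp) hX
  have hφ : Measurable fun x : {i // i ∈ ({b} : Finset ι)} → ℝ≥0∞ => x ⟨b, by simp⟩ :=
    measurable_pi_apply _
  have hψ : Measurable fun (x : {i // i ∈ (Finset.univ : Finset ι).erase b} → ℝ≥0∞) (i : ι) =>
      if hi : i = b then 0 else x ⟨i, by simp [hi]⟩ := by
    refine measurable_pi_lambda _ fun i => ?_
    by_cases hi : i = b
    · simp [hi]
    · simp only [hi, dite_false]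
      exact measurable_pi_apply _
  have h2 := h1.comp hφ hψ
  refine (h2.congr (ae_of_all _ fun ω => rfl) (ae_of_all _ fun ω => ?_))
  ext i
  by_cases hi : i = b
  · subst hi; simp
  · simp [hi]

namespace MaxID

variable {T : Type*} [MetricSpace T] [CompactSpace T]

/-- The sets of point measures that are defined by the masses of the cells of a finite
measurable partition. -/
def cylinders (T : Type*) [MetricSpace T] [CompactSpace T] : Set (Set (PointMeasure T)) :=
  {E | ∃ (ι : Type) (_ : Fintype ι) (A : ι → Set (C0 T)), (∀ i, MeasurableSet (A i)) ∧
    Pairwise (fun i j => Disjoint (A i) (A j)) ∧ (⋃ i, A i) = univ ∧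
    ∃ U : Set (ι → ℝ≥0∞), MeasurableSet U ∧ E = {M | (fun i => M.1 (A i)) ∈ U}}

theorem sum_measure_inter_partition {α ι : Type*} [MeasurableSpace α] [Fintype ι]
    (ν : Measure α) {A : ι → Set α} (hA : ∀ i, MeasurableSet (A i))
    (hd : Pairwise (fun i j => Disjoint (A i) (A j))) (hu : (⋃ i, A i) = univ)
    {B : Set α} (hB : MeasurableSet B) : ν B = ∑ i, ν (A i ∩ B) := by
  rw [← tsum_fintype (L := .unconditional _), ← measure_iUnion, ← iUnion_inter, hu, univ_inter]
  · exact fun i j hij => (hd hij).mono inter_subset_left inter_subset_left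
  · exact fun i => (hA i).inter hB

/-- Two partitions have a common refinement, and the masses of the original cells are sums of masses
of the refined ones. -/
theorem isPiSystem_cylinders : IsPiSystem (cylinders T) := by
  rintro _ ⟨ι, _, A, hA, hAd, hAu, U, hU, rfl⟩ _ ⟨κ, _, B, hB, hBd, hBu, V, hV, rfl⟩ -
  refine ⟨ι × κ, inferInstance, fun p => A p.1 ∩ B p.2, fun p => (hA _).inter (hB _), ?_, ?_,
    {x | (fun i => ∑ j, x (i, j)) ∈ U ∧ (fun j => ∑ i, x (i, j)) ∈ V}, ?_, ?_⟩
  · rintro ⟨i, j⟩ ⟨i', j'⟩ hne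
    by_cases hi : i = i'
    · have hj : j ≠ j' := fun hj => hne (by rw [hi, hj])
      exact (hBd hj).mono inter_subset_right inter_subset_right
    · exact (hAd hi).mono inter_subset_left inter_subset_left
  · ext f
    have h1 : f ∈ ⋃ i, A i := hAu ▸ mem_univ f
    have h2 : f ∈ ⋃ i, B i := hBu ▸ mem_univ f
    simp only [mem_iUnion] at h1 h2
    obtain ⟨i, hi⟩ := h1
    obtain ⟨j, hj⟩ := h2
    simp only [mem_iUnion, mem_univ, iff_true]
    exact ⟨(i, j), hi, hj⟩
  · refine MeasurableSet.inter ?_ ?_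
    · have : Measurable fun (x : ι × κ → ℝ≥0∞) i => ∑ j, x (i, j) :=
        measurable_pi_lambda _ fun i => Finset.measurable_fun_sum _ fun j _ =>
          measurable_pi_apply _
      exact this hU
    · have : Measurable fun (x : ι × κ → ℝ≥0∞) j => ∑ i, x (i, j) :=
        measurable_pi_lambda _ fun j => Finset.measurable_fun_sum _ fun i _ =>
          measurable_pi_apply _
      exact this hV
  · ext M
    have h1 : ∀ i, M.1 (A i) = ∑ j, M.1 (A i ∩ B j) := fun i => by
      rw [sum_measure_inter_partition M.1 hB hBd hBu (hA i)]
      simp_rw [inter_comm]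
    have h2 : ∀ j, M.1 (B j) = ∑ i, M.1 (A i ∩ B j) := fun j =>
      sum_measure_inter_partition M.1 hA hAd hAu (hB j)
    change ((fun i => M.1 (A i)) ∈ U ∧ (fun j => M.1 (B j)) ∈ V) ↔
      ((fun i => ∑ j, M.1 (A i ∩ B j)) ∈ U ∧ (fun j => ∑ i, M.1 (A i ∩ B j)) ∈ V)
    simp_rw [← h1, ← h2]

theorem generateFrom_cylinders :
    instMeasurableSpacePointMeasure (T := T) = MeasurableSpace.generateFrom (cylinders T) := by
  refine le_antisymm ?_ (MeasurableSpace.generateFrom_le ?_)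
  · have : @Measurable _ _ (MeasurableSpace.generateFrom (cylinders T))
        instMeasurableSpacePointMeasure (id : PointMeasure T → PointMeasure T) := by
      refine @PointMeasure.measurable_of_apply T _ _ _
        (MeasurableSpace.generateFrom (cylinders T)) id fun A hA => ?_
      intro U hU
      refine MeasurableSpace.measurableSet_generateFrom
        ⟨Bool, inferInstance, fun b => if b then A else Aᶜ, ?_, ?_, ?_,
        {x | x true ∈ U}, measurable_pi_apply true hU, ?_⟩
      · rintro (_ | _) <;> simp [hA]
      · rintro (_ | _) (_ | _) <;> simp [disjoint_compl_left, disjoint_compl_right]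
      · ext f; simp [em']
      · ext M; simp
    exact fun s hs => this hs
  · rintro _ ⟨ι, _, A, hA, -, -, U, hU, rfl⟩
    exact (measurable_pi_lambda _ fun i => PointMeasure.measurable_apply (hA i)) hU

theorem univ_mem_cylinders : univ ∈ cylinders T :=
  ⟨Unit, inferInstance, fun _ => univ, by simp, fun i j h => absurd (Subsingleton.elim i j) h,
    iUnion_const _, univ, MeasurableSet.univ, by ext; simp⟩

theorem ext_of_cylinders {m₁ m₂ : Measure (PointMeasure T)} [IsFiniteMeasure m₁]
    (h : ∀ E ∈ cylinders T, m₁ E = m₂ E) : m₁ = m₂ :=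
  ext_of_generate_finite _ generateFrom_cylinders isPiSystem_cylinders h (h _ univ_mem_cylinders)

/-! ### Independence of restrictions and the Mecke formula -/

namespace IsPoissonRandomMeasure

variable {Ω : Type*} [MeasurableSpace Ω] {P : Measure Ω}
  {μ : Measure (C0 T)} {Φ : Ω → PointMeasure T}

theorem measurable_apply (hΦ : IsPoissonRandomMeasure Φ μ P) {A : Set (C0 T)}
    (hA : MeasurableSet A) : Measurable fun ω => (Φ ω).1 A :=
  (PointMeasure.measurable_apply hA).comp hΦ.measurable

theorem prob_eq (hΦ : IsPoissonRandomMeasure Φ μ P) {A : Set (C0 T)}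
    (hA : MeasurableSet A) {U : Set ℝ≥0∞} (hU : MeasurableSet U) :
    P {ω | (Φ ω).1 A ∈ U} = poissonLaw (μ A) U := by
  rw [← hΦ.law A hA, Measure.map_apply (hΦ.measurable_apply hA) hU]
  rfl

theorem prob_zero (hΦ : IsPoissonRandomMeasure Φ μ P) {A : Set (C0 T)}
    (hA : MeasurableSet A) : P {ω | (Φ ω).1 A = 0} = EReal.exp (-(μ A : EReal)) := by
  rw [← poissonLaw_zero, ← hΦ.prob_eq hA (measurableSet_singleton 0)]
  rfl

theorem iIndepFun (hΦ : IsPoissonRandomMeasure Φ μ P) {ι : Type*} [Fintype ι]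
    {A : ι → Set (C0 T)} (hA : ∀ i, MeasurableSet (A i))
    (hd : Pairwise fun i j => Disjoint (A i) (A j)) :
    ProbabilityTheory.iIndepFun (fun i ω => (Φ ω).1 (A i)) P := by
  have e := Fintype.equivFin ι
  have h := hΦ.indep _ (fun i => A (e.symm i)) (fun i => hA _)
    (fun i j hij => hd (e.symm.injective.ne hij))
  simpa using h.precomp e.injective

/-- A restriction of a Poisson random measure is independent of its mass on a disjoint set. -/
theorem indepFun_restrict [IsProbabilityMeasure P] (hΦ : IsPoissonRandomMeasure Φ μ P)
    {S S' : Set (C0 T)} (hS : MeasurableSet S) (hS' : MeasurableSet S') (hd : Disjoint S' S) :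
    IndepFun (fun ω => (Φ ω).1 S') (fun ω => (Φ ω).restrict S) P := by
  classical
  have hm : Measurable fun ω => (Φ ω).restrict S :=
    (PointMeasure.measurable_restrict hS).comp hΦ.measurable
  have hmS' := hΦ.measurable_apply hS'
  rw [indepFun_iff_measure_inter_preimage_eq_mul]
  intro V C hV hC
  suffices h : (P.restrict ((fun ω => (Φ ω).1 S') ⁻¹' V)).map (fun ω => (Φ ω).restrict S) =
      P ((fun ω => (Φ ω).1 S') ⁻¹' V) • P.map (fun ω => (Φ ω).restrict S) by
    have := congrArg (fun m => m C) h
    simp only [Measure.smul_apply, smul_eq_mul] at this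
    rw [Measure.map_apply hm hC, Measure.map_apply hm hC, Measure.restrict_apply (hm hC)] at this
    rw [inter_comm]
    exact this
  refine ext_of_cylinders ?_
  rintro E ⟨ι, _, A, hA, hAd, hAu, U, hU, rfl⟩
  have hE : MeasurableSet {M : PointMeasure T | (fun i => M.1 (A i)) ∈ U} :=
    (measurable_pi_lambda _ fun i => PointMeasure.measurable_apply (hA i)) hU
  rw [Measure.smul_apply, Measure.map_apply hm hE, Measure.map_apply hm hE,
    Measure.restrict_apply (hm hE), inter_comm, smul_eq_mul]
  -- The extra cell `none` stands for `S'`. The family is then disjoint and complete independence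
  -- applies.
  set D : Option ι → Set (C0 T) := fun o => o.elim S' fun i => A i ∩ S with hD
  have hDm : ∀ o, MeasurableSet (D o) := by
    rintro (_ | i)
    · exact hS'
    · exact (hA i).inter hS
  have hDd : Pairwise fun i j => Disjoint (D i) (D j) := by
    rintro (_ | i) (_ | j) hij
    · exact absurd rfl hij
    · exact hd.mono le_rfl inter_subset_right
    · exact hd.symm.mono inter_subset_right le_rfl
    · exact (hAd (fun h => hij (by rw [h]))).mono inter_subset_left inter_subset_left
  have hind := ((hΦ.iIndepFun hDm hDd).indepFun_update_zero
    (fun o => hΦ.measurable_apply (hDm o)) none).comp (φ := id)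
    (ψ := fun x i => x (some i)) measurable_id
    (measurable_pi_lambda _ fun i => measurable_pi_apply _)
  have := hind.measure_inter_preimage_eq_mul V U hV hU
  convert! this using 3 <;>
  · ext ω
    simp only [hD, mem_preimage, mem_ofPred_eq, Function.comp, PointMeasure.restrict_apply _ (hA _)]
    simp

/-- The Poisson identity `E[N h(N, X)] = r E[h(N + 1, X)]`, one coordinate at a time. -/
theorem setLIntegral_cell [IsProbabilityMeasure P] (hΦ : IsPoissonRandomMeasure Φ μ P)
    {ι : Type*} [Fintype ι] [DecidableEq ι] {D : ι → Set (C0 T)} (hD : ∀ i, MeasurableSet (D i))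
    (hd : Pairwise fun i j => Disjoint (D i) (D j)) (b : ι) (hb : μ (D b) ≠ ∞)
    {U : Set (ι → ℝ≥0∞)} (hU : MeasurableSet U) :
    ∫⁻ ω in {ω | (fun i => (Φ ω).1 (D i)) ∈ U}, (Φ ω).1 (D b) ∂P =
      μ (D b) * P {ω | (fun i => (Φ ω).1 (D i)) + Pi.single b 1 ∈ U} := by
  have hm : ∀ i, Measurable fun ω => (Φ ω).1 (D i) := fun i => hΦ.measurable_apply (hD i)
  -- `Z` keeps all the masses except that of cell `b`, so it is independent of that mass and the
  -- one-dimensional identity can be applied with `Z` frozen.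
  set Z : Ω → ι → ℝ≥0∞ := fun ω => Function.update (fun i => (Φ ω).1 (D i)) b 0 with hZ
  have hZm : Measurable Z := by
    refine measurable_pi_lambda _ fun i => ?_
    by_cases hi : i = b
    · subst hi; simp [hZ]
    · simp only [hZ, Function.update_of_ne hi]; exact hm i
  have hlaw := (indepFun_iff_map_prod_eq_prod_map_map (hm b).aemeasurable hZm.aemeasurable).1
    ((hΦ.iIndepFun hD hd).indepFun_update_zero hm b)
  rw [hΦ.law _ (hD b)] at hlaw
  have hg : Measurable fun p : ℝ≥0∞ × (ι → ℝ≥0∞) => Function.update p.2 b p.1 := by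
    refine measurable_pi_lambda _ fun i => ?_
    by_cases hi : i = b
    · subst hi; simpa using measurable_fst
    · simp only [Function.update_of_ne hi]; exact (measurable_pi_apply i).comp measurable_snd
  have hg1 : Measurable fun p : ℝ≥0∞ × (ι → ℝ≥0∞) => Function.update p.2 b (p.1 + 1) :=
    hg.comp ((measurable_fst.add_const 1).prodMk measurable_snd)
  have hpair : Measurable fun ω => ((Φ ω).1 (D b), Z ω) := (hm b).prodMk hZm
  have e1 : {ω | (fun i => (Φ ω).1 (D i)) ∈ U} =
      (fun ω => ((Φ ω).1 (D b), Z ω)) ⁻¹' {p | Function.update p.2 b p.1 ∈ U} := by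
    ext ω; simp [hZ]
  have e2 : {ω | (fun i => (Φ ω).1 (D i)) + Pi.single b 1 ∈ U} =
      (fun ω => ((Φ ω).1 (D b), Z ω)) ⁻¹' {p | Function.update p.2 b (p.1 + 1) ∈ U} := by
    ext ω
    simp only [mem_ofPred_eq, mem_preimage, hZ, Function.update_idem]
    congr! 1
    ext i
    by_cases hi : i = b
    · subst hi; simp
    · simp [hi]
  have hU0 : MeasurableSet {p : ℝ≥0∞ × (ι → ℝ≥0∞) | Function.update p.2 b p.1 ∈ U} := hg hU
  have hU1 : MeasurableSet {p : ℝ≥0∞ × (ι → ℝ≥0∞) | Function.update p.2 b (p.1 + 1) ∈ U} :=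
    hg1 hU
  have : IsProbabilityMeasure (P.map Z) := Measure.isProbabilityMeasure_map hZm.aemeasurable
  rw [e1, e2, ← Measure.map_apply hpair hU1, hlaw,
    ← setLIntegral_map (f := fun p : ℝ≥0∞ × (ι → ℝ≥0∞) => p.1) hU0 measurable_fst hpair, hlaw,
    ← lintegral_indicator hU0, lintegral_prod_symm _ (by
      exact (measurable_fst.indicator hU0).aemeasurable), Measure.prod_apply_symm hU1,
    ← lintegral_const_mul _ (measurable_measure_prodMk_right hU1)]
  refine lintegral_congr fun z => ?_
  have hUz : MeasurableSet {a : ℝ≥0∞ | Function.update z b a ∈ U} :=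
    (hg.comp (measurable_id.prodMk measurable_const)) hU
  have := setLIntegral_poissonLaw hb hUz
  rw [← lintegral_indicator hUz] at this
  exact this

/-- The Mecke formula for a fixed set of finite intensity. -/
theorem setLIntegral_apply [IsProbabilityMeasure P] (hΦ : IsPoissonRandomMeasure Φ μ P)
    {B : Set (C0 T)} (hB : MeasurableSet B) (hμB : μ B ≠ ∞)
    {E : Set (PointMeasure T)} (hE : MeasurableSet E) :
    ∫⁻ ω in Φ ⁻¹' E, (Φ ω).1 B ∂P = ∫⁻ f in B, P {ω | (Φ ω).addDirac f ∈ E} ∂μ := by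
  classical
  have hadd : Measurable fun p : C0 T × Ω => (Φ p.2).addDirac p.1 :=
    PointMeasure.measurable_addDirac.comp
      (measurable_fst.prodMk (hΦ.measurable.comp measurable_snd))
  have : IsFiniteMeasure (μ.restrict B) := ⟨by simpa using hμB.lt_top⟩
  -- Read as functions of `E`, both sides are measures, the one coming from `μ.restrict B` being
  -- finite; they need only be compared on cylinders.
  suffices h : ((μ.restrict B).prod P).map (fun p => (Φ p.2).addDirac p.1) =
      (P.withDensity fun ω => (Φ ω).1 B).map Φ by
    have h1 := congrArg (fun m => m E) h
    rw [Measure.map_apply hadd hE, Measure.map_apply hΦ.measurable hE,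
      withDensity_apply _ (hΦ.measurable hE), Measure.prod_apply (hadd hE)] at h1
    exact h1.symm
  refine ext_of_cylinders ?_
  rintro E ⟨ι, _, A, hA, hAd, hAu, U, hU, rfl⟩
  have hE : MeasurableSet {M : PointMeasure T | (fun i => M.1 (A i)) ∈ U} :=
    (measurable_pi_lambda _ fun i => PointMeasure.measurable_apply (hA i)) hU
  rw [Measure.map_apply hadd hE, Measure.map_apply hΦ.measurable hE,
      withDensity_apply _ (hΦ.measurable hE), Measure.prod_apply (hadd hE)]
  -- Splitting each cell along `B` makes the mass of `B` a sum of masses of cells, and a point added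
  -- in `A i ∩ B` increments exactly one coordinate.
  set D : ι × Bool → Set (C0 T) := fun p => if p.2 then A p.1 ∩ B else A p.1 \ B with hD
  have hDm : ∀ p, MeasurableSet (D p) := by
    rintro ⟨i, _ | _⟩
    · simpa [hD] using (hA i).diff hB
    · simpa [hD] using (hA i).inter hB
  have hDA : ∀ p, D p ⊆ A p.1 := by
    rintro ⟨i, _ | _⟩
    · simp [hD]
    · simp [hD]
  have hDd : Pairwise fun i j => Disjoint (D i) (D j) := by
    rintro ⟨i, b⟩ ⟨j, c⟩ hij
    by_cases hij' : i = j
    · subst hij'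
      cases b <;> cases c
      · exact absurd rfl hij
      · simpa [hD] using (disjoint_sdiff_left.mono le_rfl inter_subset_right)
      · simpa [hD] using (disjoint_sdiff_right.mono inter_subset_right le_rfl)
      · exact absurd rfl hij
    · exact (hAd hij').mono (hDA _) (hDA _)
  set U' : Set (ι × Bool → ℝ≥0∞) := {x | (fun i => x (i, true) + x (i, false)) ∈ U} with hU'
  have hU'm : MeasurableSet U' := (measurable_pi_lambda _ fun i =>
    (measurable_pi_apply (i, true)).add (measurable_pi_apply (i, false))) hU
  have hsplit : ∀ (M : PointMeasure T) i, M.1 (A i) = M.1 (D (i, true)) + M.1 (D (i, false)) := by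
    intro M i
    simpa [hD] using (measure_inter_add_sdiff (μ := M.1) (A i) hB).symm
  have hmem : ∀ M : PointMeasure T, (fun i => M.1 (A i)) ∈ U ↔ (fun p => M.1 (D p)) ∈ U' := by
    intro M
    simp only [hU', mem_ofPred_eq, hsplit]
  have hmem' : ∀ (M : PointMeasure T) (i : ι) (f : C0 T), f ∈ A i ∩ B →
      ((fun j => (M.addDirac f).1 (A j)) ∈ U ↔
        (fun p => M.1 (D p)) + Pi.single (i, true) 1 ∈ U') := by
    intro M i f hf
    rw [hmem]
    congr! 1
    ext p
    simp only [PointMeasure.addDirac_val, Measure.coe_add, Pi.add_apply]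
    congr 1
    rw [Measure.dirac_apply' _ (hDm p)]
    by_cases hp : p = (i, true)
    · subst hp
      have : f ∈ D (i, true) := by simpa [hD] using hf
      simp [this]
    · have : f ∉ D p := fun hfp => Set.disjoint_left.1 (hDd hp) hfp (by simpa [hD] using hf)
      simp [this, hp]
  have hBsum : ∀ M : Measure (C0 T), M B = ∑ i, M (D (i, true)) := fun M => by
    rw [sum_measure_inter_partition M hA hAd hAu hB]
    simp [hD]
  have hL : ∫⁻ ω in Φ ⁻¹' {M : PointMeasure T | (fun i => M.1 (A i)) ∈ U}, (Φ ω).1 B ∂P =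
      ∑ i, μ (D (i, true)) *
        P {ω | (fun p => (Φ ω).1 (D p)) + Pi.single (i, true) 1 ∈ U'} := by
    have : Φ ⁻¹' {M : PointMeasure T | (fun i => M.1 (A i)) ∈ U} =
        {ω | (fun p => (Φ ω).1 (D p)) ∈ U'} := by
      ext ω; exact hmem (Φ ω)
    rw [this]
    simp_rw [hBsum]
    rw [lintegral_finsetSum _ fun i _ => hΦ.measurable_apply (hDm _)]
    refine Finset.sum_congr rfl fun i _ => hΦ.setLIntegral_cell hDm hDd _ ?_ hU'm
    refine ((measure_mono ?_).trans_lt hμB.lt_top).ne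
    simp [hD]
  rw [hL]
  have hBU : B = ⋃ i, A i ∩ B := by rw [← iUnion_inter, hAu, univ_inter]
  have hR : μ.restrict B = Measure.sum fun i => μ.restrict (A i ∩ B) := by
    conv_lhs => rw [hBU]
    exact Measure.restrict_iUnion
      (fun i j hij => (hAd hij).mono inter_subset_left inter_subset_left)
      (fun i => (hA i).inter hB)
  rw [hR, lintegral_sum_measure, tsum_fintype]
  refine Finset.sum_congr rfl fun i _ => ?_
  rw [setLIntegral_congr_fun (g := fun _ =>
    P {ω | (fun p => (Φ ω).1 (D p)) + Pi.single (i, true) 1 ∈ U'}) ((hA i).inter hB)]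
  · rw [setLIntegral_const, mul_comm]
    simp [hD]
  · intro f hf
    simp only
    congr 1
    ext ω
    exact hmem' (Φ ω) i f hf

/-- The Mecke formula. -/
theorem mecke [IsProbabilityMeasure P] (hΦ : IsPoissonRandomMeasure Φ μ P)
    (hμ : ∀ ε : ℝ, 0 < ε → μ {f : C0 T | ε < ‖f.1‖} < ∞)
    {D : Set (C0 T × PointMeasure T)} (hD : MeasurableSet D) :
    ∫⁻ ω, (Φ ω).1 {f | (f, Φ ω) ∈ D} ∂P =
      ∫⁻ f, P {ω | (f, (Φ ω).addDirac f) ∈ D} ∂μ := by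
  have : SigmaFinite μ := sigmaFinite_of_norm hμ
  have hS : ∀ n, MeasurableSet (shell (T := T) ⁻¹' {n}) := fun n =>
    measurable_shell (measurableSet_singleton n)
  have hSμ : ∀ n, μ (shell ⁻¹' {n}) < ∞ := fun n =>
    (measure_mono (shell_subset n)).trans_lt (hμ _ (by positivity))
  set K : Kernel Ω (C0 T) := (PointMeasure.kernel T).comap Φ hΦ.measurable with hK
  have hg : Measurable fun p : Ω × C0 T => (p.2, Φ p.1) :=
    measurable_snd.prodMk (hΦ.measurable.comp measurable_fst)
  have hadd : Measurable fun p : C0 T × Ω => (p.1, (Φ p.2).addDirac p.1) :=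
    measurable_fst.prodMk (PointMeasure.measurable_addDirac.comp
      (measurable_fst.prodMk (hΦ.measurable.comp measurable_snd)))
  -- On one norm shell both sides are measures in `D`. On a rectangle `B ×ˢ E` they reduce to the
  -- formula for the fixed set `B ∩ shell ⁻¹' {n}`, of finite intensity.
  have key : ∀ n, ((μ.restrict (shell ⁻¹' {n})).prod P).map
      (fun p => (p.1, (Φ p.2).addDirac p.1)) =
      (P ⊗ₘ (K.restrict (hS n))).map (fun p => (p.2, Φ p.1)) := by
    intro n
    have : IsFiniteMeasure (μ.restrict (shell ⁻¹' {n})) := ⟨by simpa using hSμ n⟩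
    refine Measure.ext_prod fun {B E} hB hE => ?_
    rw [Measure.map_apply hadd (hB.prod hE), Measure.map_apply hg (hB.prod hE),
      Measure.prod_apply (hadd (hB.prod hE)), Measure.compProd_apply (hg (hB.prod hE))]
    have h := hΦ.setLIntegral_apply (hB.inter (hS n))
      ((measure_mono inter_subset_right).trans_lt (hSμ n)).ne hE
    rw [← Measure.restrict_restrict hB, ← lintegral_indicator hB,
      ← lintegral_indicator (hΦ.measurable hE)] at h
    rw [eq_comm]
    convert! h using 3 with ω f
    · rw [Kernel.restrict_apply, Measure.restrict_apply
        (measurable_prodMk_left (hg (hB.prod hE)))]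
      by_cases hω : ω ∈ Φ ⁻¹' E
      · rw [indicator_of_mem hω]
        change (Φ ω).1 _ = _
        congr 1
        ext f
        simp [mem_preimage.1 hω]
      · rw [indicator_of_notMem hω]
        have : (Prod.mk ω ⁻¹' ((fun p : Ω × C0 T => (p.2, Φ p.1)) ⁻¹' B ×ˢ E)) = ∅ := by
          ext f
          simp only [mem_preimage, mem_prod, mem_empty_iff_false, iff_false, not_and]
          exact fun _ => hω
        simp [this]
    · by_cases hf : f ∈ B
      · rw [indicator_of_mem hf]
        congr 1
        ext ω
        simp [hf]
      · rw [indicator_of_notMem hf]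
        have : (Prod.mk f ⁻¹' ((fun p : C0 T × Ω => (p.1, (Φ p.2).addDirac p.1)) ⁻¹' B ×ˢ E))
            = ∅ := by
          ext ω; simp [hf]
        simp [this]
  have hR : μ = Measure.sum fun n => μ.restrict (shell ⁻¹' {n}) := by
    rw [← Measure.restrict_iUnion _ hS]
    · have : ⋃ n, shell (T := T) ⁻¹' {n} = univ := by ext; simp
      rw [this, Measure.restrict_univ]
    · intro i j hij
      refine Set.disjoint_left.2 fun x hx hy => hij ?_
      rw [← hx, ← hy]
  have hdec : ∀ ω, (Φ ω).1 {f | (f, Φ ω) ∈ D} =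
      ∑' n, K.restrict (hS n) ω {f | (f, Φ ω) ∈ D} := by
    intro ω
    have hDω : MeasurableSet {f | (f, Φ ω) ∈ D} := measurable_prodMk_right hD
    simp_rw [Kernel.restrict_apply, Measure.restrict_apply hDω]
    rw [← measure_iUnion]
    · rw [← inter_iUnion]
      have : ⋃ n, shell (T := T) ⁻¹' {n} = univ := by ext; simp
      rw [this, inter_univ]
      rfl
    · intro i j hij
      refine Set.disjoint_left.2 fun x hx hy => hij ?_
      rw [← hx.2, ← hy.2]
    · exact fun n => hDω.inter (hS n)
  simp_rw [hdec]
  rw [lintegral_tsum]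
  · conv_rhs => rw [hR]
    rw [lintegral_sum_measure]
    refine tsum_congr fun n => ?_
    have h1 := congrArg (fun m => m D) (key n)
    rw [Measure.map_apply hadd hD, Measure.map_apply hg hD,
      Measure.prod_apply (hadd hD), Measure.compProd_apply (hg hD)] at h1
    exact h1.symm
  · exact fun n => (Kernel.measurable_kernel_prodMk_left (κ := K.restrict (hS n))
      (hg hD)).aemeasurable

end IsPoissonRandomMeasure

/-! ### The pointwise maximum, extremal and sub-extremal points -/

theorem measurableSet_eval_lt (t : T) (x : ℝ) : MeasurableSet {f : C0 T | f.1 t < x} :=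
  measurable_C0_eval t measurableSet_Iio

theorem measurableSet_eval_gt (t : T) (x : ℝ) : MeasurableSet {f : C0 T | x < f.1 t} :=
  measurable_C0_eval t measurableSet_Ioi

theorem measurableSet_eval_ge (t : T) (x : ℝ) : MeasurableSet {f : C0 T | x ≤ f.1 t} :=
  measurable_C0_eval t measurableSet_Ici

theorem measurableSet_eval_eq (t : T) (x : ℝ) : MeasurableSet {f : C0 T | f.1 t = x} :=
  measurable_C0_eval t (measurableSet_singleton x)

namespace PointMeasure

theorem finite_atoms_norm_gt (M : PointMeasure T) {ε : ℝ} (hε : 0 < ε) :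
    {f ∈ M.atoms | ε < ‖f.1‖}.Finite := by
  obtain ⟨I, hI, g, hg, hfin⟩ := M.exists_rep
  refine ((hfin ε hε).image g).subset ?_
  rintro f ⟨hf, hfε⟩
  have hf' : M.1 {f} ≠ 0 := hf
  rw [hg _ (measurableSet_singleton f)] at hf'
  obtain ⟨i, hi⟩ : ∃ i, ({f} : Set (C0 T)).indicator (1 : C0 T → ℝ≥0∞) (g i) ≠ 0 := by
    by_contra! hc
    simp [hc] at hf'
  have : g i = f := by by_contra hc; simp [hc] at hi
  exact ⟨i, by simpa [this] using hfε, this⟩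

theorem bddAbove_eval (M : PointMeasure T) (s : T) :
    BddAbove (range fun f : M.atoms => f.1.1 s) := by
  obtain ⟨C, hC⟩ := ((M.finite_atoms_norm_gt one_pos).image fun f => ‖f.1‖).bddAbove
  refine ⟨Max.max C 1, ?_⟩
  rintro _ ⟨f, rfl⟩
  refine (f.1.eval_le_norm s).trans ?_
  by_cases hf : 1 < ‖f.1.1‖
  · exact le_max_of_le_left (hC ⟨f.1, ⟨f.2, hf⟩, rfl⟩)
  · exact le_max_of_le_right (not_lt.1 hf)

theorem le_max (M : PointMeasure T) {f : C0 T} (hf : f ∈ M.atoms) (s : T) :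
    f.1 s ≤ M.max s := le_ciSup (M.bddAbove_eval s) ⟨f, hf⟩

theorem max_nonneg (M : PointMeasure T) (s : T) : 0 ≤ M.max s :=
  Real.iSup_nonneg fun f => f.1.2.1 s

/-- Nonnegativity of `x` covers the zero measure, whose supremum over no atoms is `0`. -/
theorem exists_lt_of_lt_max (M : PointMeasure T) {s : T} {x : ℝ} (hx : 0 ≤ x)
    (h : x < M.max s) : ∃ f ∈ M.atoms, x < f.1 s := by
  by_contra! hc
  exact not_le.2 h (Real.iSup_le (fun f => hc f.1 f.2) hx)

/-- The maximum of a point measure is attained where it is positive. -/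
theorem exists_eq_max (M : PointMeasure T) {s : T} (h : 0 < M.max s) :
    ∃ f ∈ M.atoms, f.1 s = M.max s := by
  -- Only finitely many atoms have norm above half the maximum, and `f₀` is one of them. The atoms
  -- outside this finite set stay below `f₀` at `s`, so a largest value within the set is the
  -- overall maximum.
  obtain ⟨f₀, hf₀, hlt⟩ := M.exists_lt_of_lt_max (half_pos h).le (half_lt_self h)
  obtain ⟨f, ⟨hf, -⟩, hmax⟩ := (M.finite_atoms_norm_gt (half_pos h)).exists_maximalFor
    (fun f => f.1 s) _ ⟨f₀, hf₀, hlt.trans_le (f₀.eval_le_norm s)⟩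
  have hle : ∀ g ∈ {f ∈ M.atoms | M.max s / 2 < ‖f.1‖}, g.1 s ≤ f.1 s := fun g hg => by
    rcases le_total (g.1 s) (f.1 s) with h' | h'
    · exact h'
    · exact hmax hg h'
  have h0 := hle f₀ ⟨hf₀, hlt.trans_le (f₀.eval_le_norm s)⟩
  refine ⟨f, hf, le_antisymm (M.le_max hf s) (Real.iSup_le (fun g => ?_) (f.2.1 s))⟩
  by_cases hg : M.max s / 2 < ‖g.1.1‖
  · exact hle g.1 ⟨g.2, hg⟩
  · exact (g.1.eval_le_norm s).trans ((not_lt.1 hg).trans (hlt.le.trans h0))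

theorem max_le_iff (M : PointMeasure T) {s : T} {x : ℝ} (hx : 0 ≤ x) :
    M.max s ≤ x ↔ M.1 {f | x < f.1 s} = 0 := by
  constructor
  · intro h
    by_contra h0
    obtain ⟨f, hf, hfx⟩ := M.exists_atom (measurableSet_eval_gt s x) h0
    exact not_lt.2 ((M.le_max hf s).trans h) hfx
  · intro h
    by_contra! hlt
    obtain ⟨f, hf, hfx⟩ := M.exists_lt_of_lt_max hx hlt
    exact M.apply_ne_zero_of_atom hf (A := {f | x < f.1 s}) hfx h

theorem max_lt_iff (M : PointMeasure T) {s : T} {x : ℝ} (hx : 0 < x) :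
    M.max s < x ↔ M.1 {f | x ≤ f.1 s} = 0 := by
  constructor
  · intro h
    by_contra h0
    obtain ⟨f, hf, hfx⟩ := M.exists_atom (measurableSet_eval_ge s x) h0
    exact not_le.2 ((M.le_max hf s).trans_lt h) hfx
  · intro h
    by_contra! hle
    obtain ⟨f, hf, hfx⟩ := M.exists_eq_max (hx.trans_le hle)
    exact M.apply_ne_zero_of_atom hf (A := {f | x ≤ f.1 s}) (hle.trans hfx.ge) h

theorem measurable_max (s : T) : Measurable fun M : PointMeasure T => M.max s := by
  refine measurable_of_Iic fun x => ?_
  by_cases hx : 0 ≤ x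
  · have : (fun M : PointMeasure T => M.max s) ⁻¹' Iic x =
        (fun M : PointMeasure T => M.1 {f | x < f.1 s}) ⁻¹' {0} := by
      ext M; exact M.max_le_iff hx
    rw [this]
    exact measurable_apply (measurableSet_eval_gt s x) (measurableSet_singleton 0)
  · have : (fun M : PointMeasure T => M.max s) ⁻¹' Iic x = ∅ := by
      ext M
      simp only [mem_preimage, mem_Iic, mem_empty_iff_false, iff_false]
      exact fun h => hx ((M.max_nonneg s).trans h)
    rw [this]
    exact MeasurableSet.empty

/-- Lower semicontinuity holds for any supremum of continuous functions. Upper semicontinuity uses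
that only the finitely many atoms of norm above `x / 2` can reach the level `x`. -/
theorem continuous_max (M : PointMeasure T) : Continuous M.max := by
  rw [OrderTopology.continuous_iff]
  intro x
  constructor
  · by_cases hx : 0 ≤ x
    · have : M.max ⁻¹' Ioi x = ⋃ f ∈ M.atoms, {s | x < f.1 s} := by
        ext s
        simp only [mem_preimage, mem_Ioi, mem_iUnion, mem_ofPred_eq, exists_prop]
        exact ⟨fun h => M.exists_lt_of_lt_max hx h, fun ⟨f, hf, h⟩ => h.trans_le (M.le_max hf s)⟩
      rw [this]
      exact isOpen_biUnion fun f _ => isOpen_lt continuous_const f.1.continuous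
    · have : M.max ⁻¹' Ioi x = univ :=
        eq_univ_of_forall fun s => (not_le.1 hx).trans_le (M.max_nonneg s)
      rw [this]
      exact isOpen_univ
  · by_cases hx : 0 < x
    · have : M.max ⁻¹' Iio x =
          ⋂ f ∈ {f ∈ M.atoms | x / 2 < ‖f.1‖}, {s | f.1 s < x} := by
        ext s
        simp only [mem_preimage, mem_Iio, mem_iInter, mem_ofPred_eq, and_imp]
        refine ⟨fun h f hf _ => (M.le_max hf s).trans_lt h, fun h => ?_⟩
        by_contra! hle
        obtain ⟨f, hf, hfx⟩ := M.exists_eq_max (hx.trans_le hle)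
        have h1 := h f hf ((half_lt_self hx).trans_le
          (hle.trans (hfx.ge.trans (f.eval_le_norm s))))
        exact not_le.2 h1 (hle.trans hfx.ge)
      rw [this]
      exact (M.finite_atoms_norm_gt (half_pos hx)).isOpen_biInter
        fun f _ => isOpen_lt f.1.continuous continuous_const
    · have : M.max ⁻¹' Iio x = ∅ := by
        ext s
        simp only [mem_preimage, mem_Iio, mem_empty_iff_false, iff_false, not_lt]
        exact (not_lt.1 hx).trans (M.max_nonneg s)
      rw [this]
      exact isOpen_empty

/-- The maximum of a point measure, as a continuous function. -/
def maxC (M : PointMeasure T) : C(T, ℝ) := ⟨M.max, M.continuous_max⟩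

theorem max_eq_of_add_dirac {M M' : PointMeasure T} {f : C0 T}
    (h : M.1 = M'.1 + Measure.dirac f) (s : T) : M.max s = Max.max (f.1 s) (M'.max s) := by
  -- Both sides are nonnegative, so comparing them with every threshold `x ≥ 0` is enough, and
  -- thresholds translate into empty regions.
  have key : ∀ x, 0 ≤ x → (M.max s ≤ x ↔ Max.max (f.1 s) (M'.max s) ≤ x) := fun x hx => by
    rw [M.max_le_iff hx, _root_.max_le_iff, M'.max_le_iff hx, h, Measure.coe_add, Pi.add_apply,
      add_eq_zero, Measure.dirac_apply' _ (measurableSet_eval_gt s x), and_comm]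
    simp [indicator_apply_eq_zero]
  exact le_antisymm ((key _ (le_max_of_le_left (f.2.1 s))).2 le_rfl)
    ((key _ (M.max_nonneg s)).1 le_rfl)

theorem below_singleton (M : PointMeasure T) (t : T) :
    M.below {t} = {f | f.1 t < M.max t} := by
  ext f; simp [below]

theorem subExtremal_eq (M : PointMeasure T) (t : T) :
    M.subExtremal {t} = M.restrict {f | f.1 t < M.max t} := by
  rw [← below_singleton]; rfl

theorem extremal_eq (M : PointMeasure T) (t : T) :
    M.extremal {t} = M.restrict {f | M.max t ≤ f.1 t} := by
  have : {f : C0 T | M.max t ≤ f.1 t} = (M.below {t})ᶜ := by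
    rw [below_singleton]; ext f; simp
  rw [this]; rfl

theorem extremal_univ (M : PointMeasure T) (t : T) :
    (M.extremal {t}).1 univ = M.1 {f | M.max t ≤ f.1 t} := by
  rw [extremal_eq, restrict_apply _ MeasurableSet.univ, univ_inter]

theorem subExtremal_add_extremal (M : PointMeasure T) (t : T) :
    M.1 = (M.subExtremal {t}).1 + (M.extremal {t}).1 := by
  refine (Measure.restrict_add_restrict_compl ?_).symm
  rw [below_singleton]
  exact measurableSet_eval_lt t _

theorem measurable_subExtremal (t : T) :
    Measurable fun M : PointMeasure T => M.subExtremal {t} := by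
  simp_rw [subExtremal_eq]
  exact measurable_restrict_section (E := {p : PointMeasure T × C0 T | p.2.1 t < p.1.max t})
    (measurableSet_lt ((measurable_C0_eval t).comp measurable_snd)
      ((measurable_max t).comp measurable_fst)) measurable_id

theorem measurable_extremal (t : T) :
    Measurable fun M : PointMeasure T => M.extremal {t} := by
  simp_rw [extremal_eq]
  exact measurable_restrict_section (E := {p : PointMeasure T × C0 T | p.1.max t ≤ p.2.1 t})
    (measurableSet_le ((measurable_max t).comp measurable_fst)
      ((measurable_C0_eval t).comp measurable_snd)) measurable_id

end PointMeasure

/-! ### Regularity at `t` and uniqueness of the extremal point -/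

theorem measure_eval_ge_lt_top {μ : Measure (C0 T)}
    (hμ : ∀ ε : ℝ, 0 < ε → μ {f : C0 T | ε < ‖f.1‖} < ∞) (t : T) {x : ℝ} (hx : 0 < x) :
    μ {f | x ≤ f.1 t} < ∞ := by
  refine (measure_mono ?_).trans_lt (hμ _ (half_pos hx))
  intro f (hf : x ≤ f.1 t)
  exact (half_lt_self hx).trans_le (hf.trans (f.eval_le_norm t))

theorem measure_eval_gt_ne_top {μ : Measure (C0 T)}
    (hμ : ∀ ε : ℝ, 0 < ε → μ {f : C0 T | ε < ‖f.1‖} < ∞) (t : T) {x : ℝ} (hx : 0 < x) :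
    μ {f | x < f.1 t} ≠ ∞ := by
  refine ((measure_mono ?_).trans_lt (measure_eval_ge_lt_top hμ t hx)).ne
  exact fun f (hf : x < f.1 t) => hf.le

theorem measure_eval_eq_ne_top {μ : Measure (C0 T)}
    (hμ : ∀ ε : ℝ, 0 < ε → μ {f : C0 T | ε < ‖f.1‖} < ∞) (t : T) {x : ℝ} (hx : 0 < x) :
    μ {f | f.1 t = x} ≠ ∞ := by
  refine ((measure_mono ?_).trans_lt (measure_eval_ge_lt_top hμ t hx)).ne
  exact fun f (hf : f.1 t = x) => hf.ge

omit [CompactSpace T] in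
theorem disjoint_eval_gt_eq (t : T) (x : ℝ) :
    Disjoint {f : C0 T | x < f.1 t} {f | f.1 t = x} :=
  Set.disjoint_left.2 fun _ (hf : x < _) hf' => hf.ne' hf'

/-- The intensity has infinite mass on `{f t > 0}` and `f t` has no positive atom. -/
structure IsRegularAt (μ : Measure (C0 T)) (t : T) : Prop where
  measure_pos : μ {f | 0 < f.1 t} = ∞
  measure_eq : ∀ x : ℝ, 0 < x → μ {f | f.1 t = x} = 0

theorem exp_neg_ne_zero {r : ℝ≥0∞} (hr : r ≠ ∞) : EReal.exp (-(r : EReal)) ≠ 0 := by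
  simpa using hr

theorem tail_eq (μ : Measure (C0 T)) (t : T) {x : ℝ} (hx : 0 < x) :
    tail μ t x = μ {f | x ≤ f.1 t} := by
  rw [tail, marginal, Measure.restrict_apply measurableSet_Ici,
    Measure.map_apply (measurable_C0_eval t) (measurableSet_Ici.inter measurableSet_Ioi)]
  congr 1
  ext f
  simp only [mem_preimage, mem_inter_iff, mem_Ici, mem_Ioi, mem_ofPred_eq, and_iff_left_iff_imp]
  exact hx.trans_le

theorem isRegularAt_of_tail {μ : Measure (C0 T)}
    (hμ : ∀ ε : ℝ, 0 < ε → μ {f : C0 T | ε < ‖f.1‖} < ∞) {t : T}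
    (h0 : Tendsto (tail μ t) (𝓝[>] 0) (𝓝 ∞)) (hc : ContinuousOn (tail μ t) (Ioi 0)) :
    IsRegularAt μ t := by
  constructor
  · refine top_le_iff.1 (le_of_tendsto h0 ?_)
    filter_upwards [self_mem_nhdsWithin] with x hx
    rw [tail_eq μ t hx]
    exact measure_mono fun f (hf : x ≤ f.1 t) => show 0 < f.1 t from lt_of_lt_of_le hx hf
  · intro x hx
    -- For `y > x` the tail at `y` is at most `μ {f | x < f t}`. Letting `y` decrease to `x`,
    -- continuity leaves no mass for `{f | f t = x}`.
    have hlim : Tendsto (tail μ t) (𝓝[>] x) (𝓝 (tail μ t x)) :=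
      ((hc x hx).continuousAt (Ioi_mem_nhds hx)).mono_left nhdsWithin_le_nhds
    have hle : tail μ t x ≤ μ {f | x < f.1 t} := by
      refine le_of_tendsto hlim ?_
      filter_upwards [self_mem_nhdsWithin] with y hy
      rw [tail_eq μ t (hx.trans hy)]
      exact measure_mono fun f (hf : y ≤ f.1 t) => show x < f.1 t from lt_of_lt_of_le hy hf
    rw [tail_eq μ t hx] at hle
    have hsplit : μ {f | x ≤ f.1 t} = μ {f | f.1 t = x} + μ {f | x < f.1 t} := by
      rw [← measure_union _ (measurableSet_eval_gt t x)]
      · congr 1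
        ext f
        simp only [mem_union, mem_ofPred_eq, le_iff_eq_or_lt, eq_comm]
      · exact (disjoint_eval_gt_eq t x).symm
    have hfin := measure_eval_gt_ne_top hμ t hx
    rw [hsplit] at hle
    have := ENNReal.le_of_add_le_add_right hfin (hle.trans (zero_add _).ge)
    simpa using this

namespace IsPoissonRandomMeasure

variable {Ω : Type*} [MeasurableSpace Ω] {P : Measure Ω} [IsProbabilityMeasure P]
  {μ : Measure (C0 T)} {Φ : Ω → PointMeasure T}

/-- The masses of two disjoint sets are independent. -/
theorem prob_inter (hΦ : IsPoissonRandomMeasure Φ μ P) {S S' : Set (C0 T)}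
    (hS : MeasurableSet S) (hS' : MeasurableSet S') (hd : Disjoint S' S) {U V : Set ℝ≥0∞}
    (hU : MeasurableSet U) (hV : MeasurableSet V) :
    P {ω | (Φ ω).1 S' ∈ V ∧ (Φ ω).1 S ∈ U} = poissonLaw (μ S') V * poissonLaw (μ S) U := by
  have h := (hΦ.indepFun_restrict hS hS' hd).measure_inter_preimage_eq_mul V
    ((fun M : PointMeasure T => M.1 univ) ⁻¹' U) hV
    (PointMeasure.measurable_apply MeasurableSet.univ hU)
  rw [← hΦ.prob_eq hS' hV, ← hΦ.prob_eq hS hU]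
  simpa [preimage_preimage, PointMeasure.restrict_apply, ofPred_and] using! h

/-- If `μ {f | 0 < f t}` were finite, that region would be empty with positive probability. Every
point would then be extremal, while the independent Poisson number of remaining points is not almost
surely `1`. If `f t = x > 0` had positive intensity, then with positive probability at least two
points would sit at level `x` with none above. -/
theorem isRegularAt_of_ae_extremal (hΦ : IsPoissonRandomMeasure Φ μ P)
    (hμ : ∀ ε : ℝ, 0 < ε → μ {f : C0 T | ε < ‖f.1‖} < ∞) {t : T}
    (h : ∀ᵐ ω ∂P, ((Φ ω).extremal {t}).1 univ = 1) : IsRegularAt μ t := by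
  constructor
  · by_contra hfin
    have hS := measurableSet_eval_gt (T := T) t 0
    have h0 : P {ω | (Φ ω).1 {f | 0 < f.1 t} ∈ ({0} : Set ℝ≥0∞) ∧
        (Φ ω).1 {f | 0 < f.1 t}ᶜ ∈ ({1}ᶜ : Set ℝ≥0∞)} = 0 := by
      refine measure_mono_null ?_ h
      rintro ω ⟨hω0, hω1⟩ hω
      have hω0' : (Φ ω).1 {f | 0 < f.1 t} = 0 := hω0
      replace hω : ((Φ ω).extremal {t}).1 univ = 1 := hω
      rw [PointMeasure.extremal_univ] at hω
      have hmax : (Φ ω).max t = 0 :=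
        le_antisymm (((Φ ω).max_le_iff le_rfl).2 hω0) ((Φ ω).max_nonneg t)
      have huniv : {f : C0 T | (Φ ω).max t ≤ f.1 t} = univ :=
        eq_univ_of_forall fun f => by simpa [hmax] using f.2.1 t
      rw [huniv, ← measure_add_measure_compl hS, hω0', zero_add] at hω
      exact hω1 hω
    rw [hΦ.prob_inter hS.compl hS disjoint_compl_right (measurableSet_singleton 1).compl
      (measurableSet_singleton 0), poissonLaw_zero, mul_eq_zero] at h0
    rcases h0 with h0 | h0
    · exact exp_neg_ne_zero hfin h0
    · rw [prob_compl_eq_zero_iff (measurableSet_singleton _)] at h0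
      exact poissonLaw_one_ne _ h0
  · intro x hx
    have h0 : P {ω | (Φ ω).1 {f | x < f.1 t} ∈ ({0} : Set ℝ≥0∞) ∧
        (Φ ω).1 {f | f.1 t = x} ∈ Ici (2 : ℝ≥0∞)} = 0 := by
      refine measure_mono_null ?_ h
      rintro ω ⟨hω0, hω1⟩ hω
      have hω1' : 2 ≤ (Φ ω).1 {f | f.1 t = x} := hω1
      replace hω : ((Φ ω).extremal {t}).1 univ = 1 := hω
      rw [PointMeasure.extremal_univ] at hω
      have hmax : (Φ ω).max t ≤ x := ((Φ ω).max_le_iff hx.le).2 hω0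
      have : (2 : ℝ≥0∞) ≤ 1 := hω ▸ hω1'.trans
        (measure_mono fun f (hf : f.1 t = x) => show (Φ ω).max t ≤ f.1 t from hmax.trans hf.ge)
      norm_num at this
    rw [hΦ.prob_inter (measurableSet_eval_eq t x) (measurableSet_eval_gt t x)
      (disjoint_eval_gt_eq t x)
      measurableSet_Ici (measurableSet_singleton 0), poissonLaw_zero, mul_eq_zero] at h0
    rcases h0 with h0 | h0
    · exact absurd h0 (exp_neg_ne_zero (measure_eval_gt_ne_top hμ t hx))
    · exact eq_zero_of_poissonLaw_Ici_two (measure_eval_eq_ne_top hμ t hx) h0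

/-- A finite `μ {f | 0 < f t}` would give the maximum an atom at `0`. Positive intensity at level
`x` would give one at `x`, since with positive probability a point sits there and none above. -/
theorem isRegularAt_of_no_atom (hΦ : IsPoissonRandomMeasure Φ μ P)
    (hμ : ∀ ε : ℝ, 0 < ε → μ {f : C0 T | ε < ‖f.1‖} < ∞) {t : T}
    (h : ∀ x : ℝ, P {ω | (Φ ω).max t = x} = 0) : IsRegularAt μ t := by
  constructor
  · by_contra hfin
    refine exp_neg_ne_zero hfin ?_
    rw [← hΦ.prob_zero (measurableSet_eval_gt t 0)]
    refine measure_mono_null (fun ω hω => ?_) (h 0)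
    exact le_antisymm (((Φ ω).max_le_iff le_rfl).2 hω) ((Φ ω).max_nonneg t)
  · intro x hx
    have h0 : P {ω | (Φ ω).1 {f | x < f.1 t} ∈ ({0} : Set ℝ≥0∞) ∧
        (Φ ω).1 {f | f.1 t = x} ∈ ({0}ᶜ : Set ℝ≥0∞)} = 0 := by
      refine measure_mono_null ?_ (h x)
      rintro ω ⟨hω0, hω1⟩
      obtain ⟨f, hf, hfx⟩ := (Φ ω).exists_atom (measurableSet_eval_eq t x) hω1
      exact le_antisymm (((Φ ω).max_le_iff hx.le).2 hω0)
        ((show f.1 t = x from hfx) ▸ (Φ ω).le_max hf t)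
    rw [hΦ.prob_inter (measurableSet_eval_eq t x) (measurableSet_eval_gt t x)
      (disjoint_eval_gt_eq t x)
      (measurableSet_singleton 0).compl (measurableSet_singleton 0), poissonLaw_zero,
      mul_eq_zero] at h0
    rcases h0 with h0 | h0
    · exact absurd h0 (exp_neg_ne_zero (measure_eval_gt_ne_top hμ t hx))
    · exact eq_zero_of_poissonLaw_Ici_two (measure_eval_eq_ne_top hμ t hx)
        (measure_mono_null (fun r (hr : 2 ≤ r) => by
          rintro rfl
          simp at hr) h0)

omit [IsProbabilityMeasure P] in
theorem ae_max_pos (hΦ : IsPoissonRandomMeasure Φ μ P) {t : T} (h : IsRegularAt μ t) :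
    ∀ᵐ ω ∂P, 0 < (Φ ω).max t := by
  have h0 := hΦ.prob_zero (measurableSet_eval_gt t 0)
  rw [h.measure_pos] at h0
  refine measure_mono_null (fun ω hω => ?_) (h0.trans (by simp))
  exact ((Φ ω).max_le_iff le_rfl).1 (not_lt.1 hω)

/-- The Mecke formula is applied to the points that share their positive level at `t` with another
point. On the right side, `Φ` must already charge the level of the added point, which has intensity
`0`. Hence there are almost surely no ties at positive levels, and the maximum is positive. -/
theorem ae_extremal_univ (hΦ : IsPoissonRandomMeasure Φ μ P)
    (hμ : ∀ ε : ℝ, 0 < ε → μ {f : C0 T | ε < ‖f.1‖} < ∞) {t : T} (h : IsRegularAt μ t) :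
    ∀ᵐ ω ∂P, ((Φ ω).extremal {t}).1 univ = 1 := by
  have hE : Measurable fun p : C0 T × PointMeasure T => p.2.1 {g | g.1 t = p.1.1 t} :=
    PointMeasure.measurable_section
      (E := {q : (C0 T × PointMeasure T) × C0 T | q.2.1 t = q.1.1.1 t})
      (measurableSet_eq_fun ((measurable_C0_eval t).comp measurable_snd)
        ((measurable_C0_eval t).comp (measurable_fst.comp measurable_fst))) measurable_snd
  have hD : MeasurableSet {p : C0 T × PointMeasure T |
      0 < p.1.1 t ∧ 2 ≤ p.2.1 {g | g.1 t = p.1.1 t}} :=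
    (((measurable_C0_eval t).comp measurable_fst) measurableSet_Ioi).inter
      (hE measurableSet_Ici)
  have hmecke := hΦ.mecke hμ hD
  have hR : ∫⁻ f, P {ω | (f, (Φ ω).addDirac f) ∈ {p : C0 T × PointMeasure T |
      0 < p.1.1 t ∧ 2 ≤ p.2.1 {g | g.1 t = p.1.1 t}}} ∂μ = 0 := by
    rw [lintegral_eq_zero_iff' (by
      have := measurable_measure_prodMk_left (ν := P) ((measurable_fst.prodMk
        (PointMeasure.measurable_addDirac.comp (measurable_fst.prodMk
          (hΦ.measurable.comp measurable_snd)))) hD)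
      exact this.aemeasurable)]
    refine ae_of_all _ fun f => ?_
    by_cases hf : 0 < f.1 t
    · have h1 := hΦ.prob_eq (measurableSet_eval_eq t (f.1 t)) (measurableSet_singleton 0).compl
      rw [h.measure_eq _ hf, prob_compl_eq_one_sub (measurableSet_singleton _), poissonLaw_zero]
        at h1
      refine measure_mono_null (fun ω hω => ?_) (h1.trans (by simp))
      intro h0
      have h0' : (Φ ω).1 {g | g.1 t = f.1 t} = 0 := h0
      have hω2 : 2 ≤ ((Φ ω).addDirac f).1 {g | g.1 t = f.1 t} := hω.2
      rw [PointMeasure.addDirac_val, Measure.coe_add, Pi.add_apply, h0', zero_add,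
        Measure.dirac_apply' _ (measurableSet_eval_eq t _)] at hω2
      simp at hω2
    · simp [hf]
  rw [hR, lintegral_eq_zero_iff' (by
    have := PointMeasure.measurable_section
      (E := {q : Ω × C0 T | (q.2, Φ q.1) ∈ {p : C0 T × PointMeasure T |
        0 < p.1.1 t ∧ 2 ≤ p.2.1 {g | g.1 t = p.1.1 t}}})
      ((measurable_snd.prodMk (hΦ.measurable.comp measurable_fst)) hD) hΦ.measurable
    exact this.aemeasurable)] at hmecke
  filter_upwards [hmecke, hΦ.ae_max_pos h] with ω hω hpos
  have hω' : (Φ ω).1 {f | 0 < f.1 t ∧ 2 ≤ (Φ ω).1 {g | g.1 t = f.1 t}} = 0 := hω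
  rw [PointMeasure.extremal_univ]
  have hge : MeasurableSet {f : C0 T | (Φ ω).max t ≤ f.1 t} := measurableSet_eval_ge t _
  have hgt := ((Φ ω).max_le_iff ((Φ ω).max_nonneg t)).1 (le_refl ((Φ ω).max t))
  obtain ⟨f, hf, hfm⟩ := (Φ ω).exists_eq_max hpos
  refine le_antisymm ?_ ((Φ ω).one_le_of_ne_zero hge ((Φ ω).apply_ne_zero_of_atom hf hfm.ge))
  by_contra! h1
  have h2 := (Φ ω).two_le_of_one_lt hge h1
  have hunion : {f : C0 T | (Φ ω).max t ≤ f.1 t} ⊆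
      {f | f.1 t = (Φ ω).max t} ∪ {f | (Φ ω).max t < f.1 t} :=
    fun f (hf : (Φ ω).max t ≤ f.1 t) => hf.eq_or_lt.imp Eq.symm id
  have heq : (Φ ω).1 {f | (Φ ω).max t ≤ f.1 t} ≤ (Φ ω).1 {f | f.1 t = (Φ ω).max t} :=
    (measure_mono hunion).trans ((measure_union_le _ _).trans (by rw [hgt, add_zero]))
  have hsub : (Φ ω).1 {f | f.1 t = (Φ ω).max t} = 0 := by
    refine measure_mono_null (fun f (hf : f.1 t = (Φ ω).max t) => ?_) hω'
    refine ⟨hf ▸ hpos, ?_⟩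
    rw [hf]
    exact h2.trans heq
  rw [hsub] at heq
  have := h2.trans heq
  simp at this

theorem exists_extremal_function (hΦ : IsPoissonRandomMeasure Φ μ P) {t : T}
    (h : ∀ᵐ ω ∂P, ((Φ ω).extremal {t}).1 univ = 1) :
    ∃ φ : Ω → C0 T, Measurable φ ∧
      ∀ᵐ ω ∂P, ((Φ ω).extremal {t}).1 = Measure.dirac (φ ω) := by
  classical
  have hm : ∀ A, MeasurableSet A → Measurable fun ω => ((Φ ω).extremal {t}).1 A := fun A hA =>
    (PointMeasure.measurable_apply hA).comp
      ((PointMeasure.measurable_extremal t).comp hΦ.measurable)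
  -- `f₀` only serves as a default value off the almost sure event.
  obtain ⟨ω₀, hω₀⟩ := h.exists
  obtain ⟨f₀, -⟩ := PointMeasure.eq_dirac_of_univ _ hω₀
  have hex : ∀ ω, ∃ f, ((Φ ω).extremal {t}).1 univ = 1 →
      ((Φ ω).extremal {t}).1 = Measure.dirac f := fun ω => by
    by_cases hω : ((Φ ω).extremal {t}).1 univ = 1
    · obtain ⟨f, hf⟩ := PointMeasure.eq_dirac_of_univ _ hω
      exact ⟨f, fun _ => hf⟩
    · exact ⟨f₀, fun h => absurd h hω⟩
  choose φ hφ using hex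
  have hG : MeasurableSet {ω | ((Φ ω).extremal {t}).1 univ = 1} :=
    hm univ MeasurableSet.univ (measurableSet_singleton 1)
  refine ⟨fun ω => if ((Φ ω).extremal {t}).1 univ = 1 then φ ω else f₀, ?_, ?_⟩
  · intro B hB
    -- The choice of `φ` is not measurable a priori. On the good event, however, `φ ω ∈ B` means
    -- that the extremal measure gives mass `1` to `B`.
    have : (fun ω => if ((Φ ω).extremal {t}).1 univ = 1 then φ ω else f₀) ⁻¹' B =
        ({ω | ((Φ ω).extremal {t}).1 univ = 1} ∩ {ω | ((Φ ω).extremal {t}).1 B = 1}) ∪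
        ({ω | ((Φ ω).extremal {t}).1 univ = 1}ᶜ ∩ {_ω | f₀ ∈ B}) := by
      ext ω
      by_cases hω : ((Φ ω).extremal {t}).1 univ = 1
      · have h1 : ((Φ ω).extremal {t}).1 B = 1 ↔ φ ω ∈ B := by
          rw [hφ ω hω, Measure.dirac_apply' _ hB]
          simp [indicator_apply]
        simp [hω, h1]
      · simp [hω]
    rw [this]
    exact (hG.inter (hm B hB (measurableSet_singleton 1))).union
      (hG.compl.inter (MeasurableSet.const _))
  · filter_upwards [h] with ω hω
    rw [if_pos hω, hφ ω hω]

end IsPoissonRandomMeasure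

/-! ### Laws of restrictions below a level -/

theorem IsPoissonRandomMeasure.restrict {Ω : Type*} [MeasurableSpace Ω] {P : Measure Ω}
    {μ : Measure (C0 T)} {Φ : Ω → PointMeasure T} (hΦ : IsPoissonRandomMeasure Φ μ P)
    {S : Set (C0 T)} (hS : MeasurableSet S) :
    IsPoissonRandomMeasure (fun ω => (Φ ω).restrict S) (μ.restrict S) P where
  measurable := (PointMeasure.measurable_restrict hS).comp hΦ.measurable
  law A hA := by
    simp_rw [PointMeasure.restrict_apply _ hA]
    rw [hΦ.law _ (hA.inter hS), Measure.restrict_apply hA]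
  indep n A hA hd := by
    simp_rw [fun ω i => PointMeasure.restrict_apply (Φ ω) (S := S) (hA i)]
    exact hΦ.indep n (fun i => A i ∩ S) (fun i => (hA i).inter hS)
      fun i j hij => (hd hij).mono inter_subset_left inter_subset_left

/-- The distribution of a Poisson random measure is the law of a Poisson random measure. -/
theorem IsPoissonRandomMeasure.isPoissonRandomMeasureLaw_map {Ω : Type*} [MeasurableSpace Ω]
    {P : Measure Ω} [IsProbabilityMeasure P]
    {μ : Measure (C0 T)} {Φ : Ω → PointMeasure T} (hΦ : IsPoissonRandomMeasure Φ μ P) :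
    IsPoissonRandomMeasureLaw (P.map Φ) μ where
  measurable := measurable_id
  law A hA := by
    rw [Measure.map_map (PointMeasure.measurable_apply hA) hΦ.measurable]
    exact hΦ.law A hA
  indep n A hA hd := by
    have : IsProbabilityMeasure (P.map Φ) :=
      Measure.isProbabilityMeasure_map hΦ.measurable.aemeasurable
    have h := hΦ.indep n A hA hd
    rw [iIndepFun_iff_map_fun_eq_pi_map fun i => (hΦ.measurable_apply (hA i)).aemeasurable] at h
    rw [iIndepFun_iff_map_fun_eq_pi_map
      fun i => (PointMeasure.measurable_apply (hA i)).aemeasurable,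
      Measure.map_map (measurable_pi_lambda _ fun i => PointMeasure.measurable_apply (hA i))
        hΦ.measurable]
    simp_rw [fun i => Measure.map_map (μ := P) (PointMeasure.measurable_apply (hA i))
      hΦ.measurable]
    exact h

omit [CompactSpace T] in
theorem measurable_exp_neg_measure_gt (μ : Measure (C0 T)) (t : T) :
    Measurable fun y : ℝ => EReal.exp (-(μ {f | y < f.1 t} : EReal)) := by
  refine Monotone.measurable fun x y hxy => EReal.exp_monotone ?_
  refine EReal.neg_le_neg_iff.2 (EReal.coe_ennreal_le_coe_ennreal_iff.2 (measure_mono ?_))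
  exact fun f (hf : y < f.1 t) => lt_of_le_of_lt hxy hf

theorem measurable_restrict_eval_lt {Ω : Type*} [MeasurableSpace Ω] {Φ : Ω → PointMeasure T}
    (hΦ : Measurable Φ) (t : T) :
    Measurable fun p : ℝ × Ω => (Φ p.2).restrict {f | f.1 t < p.1} :=
  PointMeasure.measurable_restrict_section (E := {q : (ℝ × Ω) × C0 T | q.2.1 t < q.1.1})
    (measurableSet_lt ((measurable_C0_eval t).comp measurable_snd)
      (measurable_fst.comp measurable_fst)) (hΦ.comp measurable_snd)

/-- The kernel sending `y` to the law of the restriction of `Φ` to `{f | f t < y}`. -/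
def restrictKernel {Ω : Type*} [MeasurableSpace Ω] (P : Measure Ω) [SFinite P]
    {Φ : Ω → PointMeasure T} (hΦ : Measurable Φ) (t : T) : Kernel ℝ (PointMeasure T) where
  toFun y := P.map fun ω => (Φ ω).restrict {f | f.1 t < y}
  measurable' := by
    refine Measure.measurable_of_measurable_coe _ fun C hC => ?_
    have h := measurable_restrict_eval_lt hΦ t
    have hmap : ∀ y : ℝ, P.map (fun ω => (Φ ω).restrict {f | f.1 t < y}) C =
        P (Prod.mk y ⁻¹' ((fun p : ℝ × Ω => (Φ p.2).restrict {f | f.1 t < p.1}) ⁻¹' C)) :=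
      fun y => Measure.map_apply (h.comp (measurable_prodMk_left (x := y))) hC
    simp_rw [hmap]
    exact measurable_measure_prodMk_left (h hC)

section RestrictKernel

variable {Ω : Type*} [MeasurableSpace Ω] {P : Measure Ω} {Φ : Ω → PointMeasure T}

theorem restrictKernel_apply [SFinite P] (hΦ : Measurable Φ) (t : T) (y : ℝ)
    {C : Set (PointMeasure T)} (hC : MeasurableSet C) :
    restrictKernel P hΦ t y C = P {ω | (Φ ω).restrict {f | f.1 t < y} ∈ C} := by
  exact Measure.map_apply
    ((PointMeasure.measurable_restrict (measurableSet_eval_lt t y)).comp hΦ) hC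

instance isMarkovKernel_restrictKernel [IsProbabilityMeasure P] (hΦ : Measurable Φ) (t : T) :
    IsMarkovKernel (restrictKernel P hΦ t) :=
  ⟨fun y => Measure.isProbabilityMeasure_map
    ((PointMeasure.measurable_restrict (measurableSet_eval_lt t y)).comp hΦ).aemeasurable⟩

theorem IsPoissonRandomMeasure.isPoissonRandomMeasureLaw_restrictKernel [IsProbabilityMeasure P]
    {μ : Measure (C0 T)} (hΦ : IsPoissonRandomMeasure Φ μ P) (t : T) (y : ℝ) :
    IsPoissonRandomMeasureLaw (restrictKernel P hΦ.measurable t y) (μ.restrict {f | f.1 t < y}) :=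
  (hΦ.restrict (measurableSet_eval_lt t y)).isPoissonRandomMeasureLaw_map

end RestrictKernel

/-! ### Extremal configurations and the joint law -/

namespace PointMeasure

/-- The configurations in which `f` is a `t`-extremal point, `f t` belongs to `A`, and `f` together
with the points that are smaller than `f` at `t` belongs to `B`. -/
def extremalConfig (t : T) (A : Set ℝ) (B : Set (C0 T × PointMeasure T)) :
    Set (C0 T × PointMeasure T) :=
  {p | p.1.1 t ∈ A ∧ p.2.1 {g | p.1.1 t < g.1 t} = 0 ∧
    (p.1, p.2.restrict {g | g.1 t < p.1.1 t}) ∈ B}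

theorem measurableSet_extremalConfig (t : T) {A : Set ℝ} (hA : MeasurableSet A)
    {B : Set (C0 T × PointMeasure T)} (hB : MeasurableSet B) :
    MeasurableSet (extremalConfig t A B) := by
  have h1 : Measurable fun p : C0 T × PointMeasure T => p.2.1 {g | p.1.1 t < g.1 t} :=
    measurable_section (E := {q : (C0 T × PointMeasure T) × C0 T | q.1.1.1 t < q.2.1 t})
      (measurableSet_lt ((measurable_C0_eval t).comp (measurable_fst.comp measurable_fst))
        ((measurable_C0_eval t).comp measurable_snd)) measurable_snd
  have h2 : Measurable fun p : C0 T × PointMeasure T =>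
      p.2.restrict {g | g.1 t < p.1.1 t} :=
    (measurable_restrict_eval_lt measurable_id t).comp
      (((measurable_C0_eval t).comp measurable_fst).prodMk measurable_snd)
  exact (((measurable_C0_eval t).comp measurable_fst) hA).inter
    ((h1 (measurableSet_singleton 0)).inter ((measurable_fst.prodMk h2) hB))

theorem eval_eq_max_of_extremal_eq_dirac {M : PointMeasure T} {t : T} {φ : C0 T}
    (h : (M.extremal {t}).1 = Measure.dirac φ) : φ.1 t = M.max t := by
  rw [extremal_eq] at h
  have hsing := congrArg (fun m => m {φ}) h
  have hlt := congrArg (fun m => m {f | f.1 t < M.max t}) h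
  simp only [restrict_apply M (measurableSet_singleton φ),
    restrict_apply M (measurableSet_eval_lt t _),
    Measure.dirac_apply' _ (measurableSet_eval_lt t _)] at hsing hlt
  refine le_antisymm (M.le_max (fun h0 => ?_) t) ?_
  · rw [measure_mono_null inter_subset_left h0] at hsing
    simp at hsing
  · by_contra! hc
    have : {f : C0 T | f.1 t < M.max t} ∩ {f | M.max t ≤ f.1 t} = ∅ := by
      ext f; simp
    rw [this] at hlt
    simp [hc] at hlt

/-- A sub-extremal point has the extremal one above it, so only `φ` can satisfy the configuration.
The number of such points is then the indicator of an event, which converts the left side of the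
Mecke formula into a probability. -/
theorem apply_extremalConfig {M : PointMeasure T} {t : T} {φ : C0 T}
    (h : (M.extremal {t}).1 = Measure.dirac φ) {A : Set ℝ} (hA : MeasurableSet A)
    {B : Set (C0 T × PointMeasure T)} (hB : MeasurableSet B) :
    M.1 {f | (f, M) ∈ extremalConfig t A B} =
      {p : ℝ × C0 T × PointMeasure T | p.1 ∈ A ∧ p.2 ∈ B}.indicator 1
        (M.max t, φ, M.subExtremal {t}) := by
  classical
  have hX : MeasurableSet {f | (f, M) ∈ extremalConfig t A B} :=
    measurable_prodMk_right (measurableSet_extremalConfig t hA hB)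
  have hφ := eval_eq_max_of_extremal_eq_dirac h
  have huniv : M.1 {f | M.max t ≤ f.1 t} = 1 := by
    rw [← extremal_univ, h, measure_univ]
  have h0 : (M.subExtremal {t}).1 {f | (f, M) ∈ extremalConfig t A B} = 0 := by
    rw [subExtremal_eq, restrict_apply _ hX]
    convert measure_empty (μ := M.1)
    ext f
    simp only [mem_inter_iff, mem_ofPred_eq, mem_empty_iff_false, iff_false, not_and]
    rintro ⟨-, hf, -⟩ hlt
    have hsub : {g : C0 T | M.max t ≤ g.1 t} ⊆ {g | f.1 t < g.1 t} :=
      fun g (hg : M.max t ≤ g.1 t) => lt_of_lt_of_le hlt hg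
    have := measure_mono_null hsub hf
    rw [huniv] at this
    exact one_ne_zero this
  have hgt := (M.max_le_iff (M.max_nonneg t)).1 (le_refl (M.max t))
  have hmem : φ ∈ {f | (f, M) ∈ extremalConfig t A B} ↔
      (M.max t, φ, M.subExtremal {t}) ∈ {p : ℝ × C0 T × PointMeasure T | p.1 ∈ A ∧ p.2 ∈ B} := by
    simp only [extremalConfig, mem_ofPred_eq, hφ, hgt, true_and, subExtremal_eq]
  rw [subExtremal_add_extremal M t, Measure.add_apply, h0, zero_add, h,
    Measure.dirac_apply' _ hX]
  simp only [indicator_apply, hmem, Pi.one_apply]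

end PointMeasure

namespace IsPoissonRandomMeasure

variable {Ω : Type*} [MeasurableSpace Ω] {P : Measure Ω} [IsProbabilityMeasure P]
  {μ : Measure (C0 T)} {Φ : Ω → PointMeasure T}

/-- The joint law of the value `η(t)`, of the extremal function, and of the sub-extremal
point measure. -/
theorem prob_extremal (hΦ : IsPoissonRandomMeasure Φ μ P)
    (hμ : ∀ ε : ℝ, 0 < ε → μ {f : C0 T | ε < ‖f.1‖} < ∞) {t : T} (h : IsRegularAt μ t)
    {κ : Kernel ℝ (C0 T)} (hκ : IsRegularCondMeasure μ t κ) {φ : Ω → C0 T} (hφ : Measurable φ)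
    (hdirac : ∀ᵐ ω ∂P, ((Φ ω).extremal {t}).1 = Measure.dirac (φ ω))
    {A : Set ℝ} (hA : MeasurableSet A) {B : Set (C0 T × PointMeasure T)} (hB : MeasurableSet B) :
    P ((fun ω => (Φ ω).max t) ⁻¹' A ∩ (fun ω => (φ ω, (Φ ω).subExtremal {t})) ⁻¹' B) =
      ∫⁻ y in A, EReal.exp (-(μ {f | y < f.1 t} : EReal)) *
        (κ ×ₖ restrictKernel P hΦ.measurable t) y B ∂(marginal μ t) := by
  classical
  have := hκ.isMarkov
  set R := restrictKernel P hΦ.measurable t with hR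
  set w : ℝ → ℝ≥0∞ := fun y => EReal.exp (-(μ {f | y < f.1 t} : EReal)) with hw
  have hwm : Measurable w := measurable_exp_neg_measure_gt μ t
  have hmax : Measurable fun ω => (Φ ω).max t :=
    (PointMeasure.measurable_max t).comp hΦ.measurable
  have hsub : Measurable fun ω => (Φ ω).subExtremal {t} :=
    (PointMeasure.measurable_subExtremal t).comp hΦ.measurable
  have hG := (hmax hA).inter ((hφ.prodMk hsub) hB)
  have hL : P ((fun ω => (Φ ω).max t) ⁻¹' A ∩ (fun ω => (φ ω, (Φ ω).subExtremal {t})) ⁻¹' B) =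
      ∫⁻ ω, (Φ ω).1 {f | (f, Φ ω) ∈ PointMeasure.extremalConfig t A B} ∂P := by
    rw [← lintegral_indicator_one hG]
    refine lintegral_congr_ae ?_
    filter_upwards [hdirac] with ω hω
    rw [PointMeasure.apply_extremalConfig hω hA hB]
    simp only [indicator_apply]
    rfl
  rw [hL, hΦ.mecke hμ (PointMeasure.measurableSet_extremalConfig t hA hB)]
  set F : ℝ → C0 T → ℝ≥0∞ := fun y f => A.indicator 1 y * w y * R y {M | (f, M) ∈ B} with hF
  have hBf : ∀ f, MeasurableSet {M | (f, M) ∈ B} := fun f => measurable_prodMk_left hB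
  have hRm : Measurable fun p : ℝ × C0 T => R p.1 {M | (p.2, M) ∈ B} :=
    Kernel.measurable_kernel_prodMk_left (κ := R.comap Prod.fst measurable_fst)
      (t := {q : (ℝ × C0 T) × PointMeasure T | (q.1.2, q.2) ∈ B})
      (((measurable_snd.comp measurable_fst).prodMk measurable_snd) hB)
  have hFm : Measurable (Function.uncurry F) :=
    (((measurable_one.indicator hA).comp measurable_fst).mul (hwm.comp measurable_fst)).mul hRm
  -- The disintegration requires `F` to vanish at level `0`, even when `0 ∈ A`. This holds because
  -- `μ {f | 0 < f t} = ∞` makes the weight `exp(-∞) = 0`.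
  have hF0 : ∀ f, F 0 f = 0 := fun f => by
    simp [hF, hw, h.measure_pos]
  have hint : ∀ f, P {ω | (f, (Φ ω).addDirac f) ∈ PointMeasure.extremalConfig t A B} =
      F (f.1 t) f := by
    intro f
    have hgt := measurableSet_eval_gt (T := T) t (f.1 t)
    have hlt := measurableSet_eval_lt (T := T) t (f.1 t)
    -- The added point `f` sits exactly at level `f t`, so both strict regions ignore it.
    have hset : {ω | (f, (Φ ω).addDirac f) ∈ PointMeasure.extremalConfig t A B} =
        {ω | f.1 t ∈ A ∧ (Φ ω).1 {g | f.1 t < g.1 t} = 0 ∧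
          (f, (Φ ω).restrict {g | g.1 t < f.1 t}) ∈ B} := by
      ext ω
      have h1 : ((Φ ω).addDirac f).1 {g | f.1 t < g.1 t} = (Φ ω).1 {g | f.1 t < g.1 t} := by
        simp [PointMeasure.addDirac_val, Measure.dirac_apply' _ hgt]
      have h2 : ((Φ ω).addDirac f).restrict {g | g.1 t < f.1 t} =
          (Φ ω).restrict {g | g.1 t < f.1 t} := by
        refine Subtype.ext ?_
        change ((Φ ω).1 + Measure.dirac f).restrict _ = (Φ ω).1.restrict _
        rw [Measure.restrict_add, restrict_dirac' hlt]
        simp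
      simp only [PointMeasure.extremalConfig, mem_ofPred_eq, h1, h2]
    rw [hset]
    by_cases hfA : f.1 t ∈ A
    · have hind := (hΦ.indepFun_restrict hlt hgt (Set.disjoint_left.2
        fun g (hg : f.1 t < g.1 t) (hg' : g.1 t < f.1 t) => lt_asymm hg hg')).measure_inter_preimage_eq_mul
        {0} {M | (f, M) ∈ B} (measurableSet_singleton 0) (hBf f)
      have hv := hΦ.prob_zero hgt
      simp only [hF, hR, restrictKernel_apply _ _ _ (hBf f), indicator_of_mem hfA, Pi.one_apply,
        one_mul, hfA, true_and, hw]
      rw [← hv]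
      exact hind
    · simp [hF, hfA]
  simp_rw [hint]
  rw [hκ.disintegration F hFm hF0, ← lintegral_indicator hA]
  refine lintegral_congr fun y => ?_
  have hmy : Measurable fun f => R y {M | (f, M) ∈ B} := measurable_measure_prodMk_left hB
  simp only [hF]
  rw [lintegral_const_mul _ hmy]
  by_cases hy : y ∈ A
  · simp only [indicator_of_mem hy, Pi.one_apply, one_mul]
    rw [Kernel.prod_apply' _ _ _ hB]
    rfl
  · simp [hy]

theorem isRegularCondDistrib_extremal (hΦ : IsPoissonRandomMeasure Φ μ P)
    (hμ : ∀ ε : ℝ, 0 < ε → μ {f : C0 T | ε < ‖f.1‖} < ∞) {t : T} (h : IsRegularAt μ t)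
    {κ : Kernel ℝ (C0 T)} (hκ : IsRegularCondMeasure μ t κ) {φ : Ω → C0 T} (hφ : Measurable φ)
    (hdirac : ∀ᵐ ω ∂P, ((Φ ω).extremal {t}).1 = Measure.dirac (φ ω)) :
    IsRegularCondDistrib (fun ω => (φ ω, (Φ ω).subExtremal {t})) (fun ω => (Φ ω).max t) P
      (κ ×ₖ restrictKernel P hΦ.measurable t) := by
  have := hκ.isMarkov
  have hmax : Measurable fun ω => (Φ ω).max t :=
    (PointMeasure.measurable_max t).comp hΦ.measurable
  refine ⟨hφ.prodMk ((PointMeasure.measurable_subExtremal t).comp hΦ.measurable), hmax,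
    inferInstance, fun A B hA hB => ?_⟩
  have hwm := measurable_exp_neg_measure_gt μ t
  -- The joint law with `B` everything shows that `η t` has density `exp(-μ{f t > y})` with respect
  -- to the marginal.
  have hlaw : P.map (fun ω => (Φ ω).max t) = (marginal μ t).withDensity
      fun y => EReal.exp (-(μ {f | y < f.1 t} : EReal)) := by
    ext A hA
    have h1 := hΦ.prob_extremal hμ h hκ hφ hdirac hA MeasurableSet.univ
    rw [Measure.map_apply hmax hA, withDensity_apply _ hA]
    simpa using h1
  rw [hΦ.prob_extremal hμ h hκ hφ hdirac hA hB, hlaw,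
    setLIntegral_withDensity_eq_setLIntegral_mul _ hwm (Kernel.measurable_coe _ hB) hA]
  rfl

end IsPoissonRandomMeasure

/-! ### Conditional law of the process -/

/-- The pointwise maximum of a function and of the points of a point measure. -/
def supMax (p : C0 T × PointMeasure T) : C(T, ℝ) := p.1.1 ⊔ p.2.maxC

theorem supMax_apply (p : C0 T × PointMeasure T) (s : T) :
    supMax p s = max (p.1.1 s) (p.2.max s) := rfl

theorem measurable_supMax : Measurable (supMax (T := T)) :=
  measurable_of_eval fun s => ((measurable_C0_eval s).comp measurable_fst).max
    ((PointMeasure.measurable_max s).comp measurable_snd)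

theorem measurableSet_forall_eval_lt {ι : Type*} [Countable ι] (s : ι → T) (z : ι → ℝ) :
    MeasurableSet {g : C(T, ℝ) | ∀ i, g (s i) < z i} := by
  rw [ofPred_forall]
  exact MeasurableSet.iInter fun i => measurable_eval (s i) measurableSet_Iio

namespace IsPoissonRandomMeasure

variable {Ω : Type*} [MeasurableSpace Ω] {P : Measure Ω} [IsProbabilityMeasure P]
  {μ : Measure (C0 T)} {Φ : Ω → PointMeasure T}

/-- Almost surely `Φ` is the sub-extremal measure plus the Dirac mass at `φ`, so `η` is `supMax` of
the pair, and its conditional law is the image of that of the pair. -/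
theorem condDistrib_max (hΦ : IsPoissonRandomMeasure Φ μ P)
    {t : T} {φ : Ω → C0 T}
    (hdirac : ∀ᵐ ω ∂P, ((Φ ω).extremal {t}).1 = Measure.dirac (φ ω))
    {η : Ω → C(T, ℝ)} (hη : ∀ ω s, η ω s = (Φ ω).max s)
    {K : Kernel ℝ (C0 T × PointMeasure T)}
    (hK : IsRegularCondDistrib (fun ω => (φ ω, (Φ ω).subExtremal {t})) (fun ω => η ω t) P K) :
    condDistrib η (fun ω => η ω t) P =ᵐ[P.map fun ω => η ω t] K.map supMax := by
  have := hK.isMarkov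
  have hηm : Measurable η := measurable_of_eval fun s => by
    simp_rw [hη]
    exact (PointMeasure.measurable_max s).comp hΦ.measurable
  have hηt : Measurable fun ω => η ω t := (measurable_eval t).comp hηm
  have : IsMarkovKernel (K.map (supMax (T := T))) := Kernel.IsMarkovKernel.map _ measurable_supMax
  refine condDistrib_ae_eq_of_measure_eq_compProd_of_measurable hηt hηm ?_
  have : IsProbabilityMeasure (P.map fun ω => (η ω t, η ω)) :=
    Measure.isProbabilityMeasure_map (hηt.prodMk hηm).aemeasurable
  refine Measure.ext_prod fun {A C} hA hC => ?_
  rw [Measure.map_apply (hηt.prodMk hηm) (hA.prod hC), Measure.compProd_apply_prod hA hC]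
  simp_rw [Kernel.map_apply' _ measurable_supMax _ hC]
  rw [← hK.eq_lintegral A _ hA (measurable_supMax hC)]
  refine measure_congr ?_
  filter_upwards [hdirac] with ω hω
  have hsup : supMax (φ ω, (Φ ω).subExtremal {t}) = η ω := by
    ext s
    have hsum := (Φ ω).subExtremal_add_extremal t
    rw [hω] at hsum
    rw [supMax_apply, hη, PointMeasure.max_eq_of_add_dirac hsum]
  refine propext ?_
  change (η ω t ∈ A ∧ η ω ∈ C) ↔
    (η ω t ∈ A ∧ supMax (φ ω, (Φ ω).subExtremal {t}) ∈ C)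
  rw [hsup]

omit [IsProbabilityMeasure P] in
/-- The finite-dimensional distribution function of the maximum of a Poisson random measure. -/
theorem prob_forall_max_lt (hΦ : IsPoissonRandomMeasure Φ μ P) {ι : Type*} [Countable ι]
    (s : ι → T) {z : ι → ℝ} (hz : ∀ i, 0 < z i) :
    P {ω | ∀ i, (Φ ω).max (s i) < z i} =
      EReal.exp (-(μ {f | ¬ ∀ i, f.1 (s i) < z i} : EReal)) := by
  have hS : {f : C0 T | ¬ ∀ i, f.1 (s i) < z i} = ⋃ i, {f | z i ≤ f.1 (s i)} := by
    ext f; simp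
  rw [hS, ← hΦ.prob_zero (MeasurableSet.iUnion fun i => measurableSet_eval_ge (s i) (z i))]
  congr 1
  ext ω
  simp only [mem_ofPred_eq, measure_iUnion_null_iff]
  exact forall_congr' fun i => (Φ ω).max_lt_iff (hz i)

theorem map_supMax_apply (hΦ : IsPoissonRandomMeasure Φ μ P) {κ : Kernel ℝ (C0 T)}
    [IsMarkovKernel κ] (t : T) (y : ℝ) {l : ℕ} (s : Fin l → T) (z : Fin l → ℝ) :
    (κ ×ₖ restrictKernel P hΦ.measurable t).map supMax y {g | ∀ i, g (s i) < z i} =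
      κ y {f | ∀ i, f.1 (s i) < z i} *
        EReal.exp (-((μ {f | (¬ ∀ i, f.1 (s i) < z i) ∧ f.1 t < y} : ℝ≥0∞) : EReal)) := by
  rw [Kernel.map_apply' _ measurable_supMax _ (measurableSet_forall_eval_lt s z)]
  have hpre : supMax ⁻¹' {g : C(T, ℝ) | ∀ i, g (s i) < z i} =
      {f : C0 T | ∀ i, f.1 (s i) < z i} ×ˢ {M : PointMeasure T | ∀ i, M.max (s i) < z i} := by
    ext p
    simp [supMax_apply, forall_and]
  rw [hpre, Kernel.prod_apply_prod]
  -- If some `z i ≤ 0`, nonnegativity makes `{f | ∀ i, f (s i) < z i}` empty and both sides vanish.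
  -- Otherwise the second factor is a void probability of the restricted Poisson measure.
  by_cases hpos : ∀ i, 0 < z i
  · congr 1
    have hm : MeasurableSet {f : C0 T | ¬ ∀ i, f.1 (s i) < z i} :=
      (measurable_subtype_coe (measurableSet_forall_eval_lt s z)).compl
    have hlaw := hΦ.isPoissonRandomMeasureLaw_restrictKernel t y
    refine (IsPoissonRandomMeasure.prob_forall_max_lt hlaw s hpos).trans ?_
    rw [Measure.restrict_apply hm]
    rfl
  · obtain ⟨i, hi⟩ := not_forall.1 hpos
    have : {f : C0 T | ∀ i, f.1 (s i) < z i} = ∅ := by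
      ext f
      simp only [mem_ofPred_eq, mem_empty_iff_false, iff_false, not_forall, not_lt]
      exact ⟨i, (not_lt.1 hi).trans (f.2.1 _)⟩
    simp [this]

end IsPoissonRandomMeasure

end MaxID

end

/-! ### The conditional law of extremal function, sub-extremal measure and process -/

theorem proposition4p1 {T : Type*} [MetricSpace T] [CompactSpace T]
    {Ω : Type*} [MeasurableSpace Ω] (P : Measure Ω) [IsProbabilityMeasure P]
    -- the exponent measure
    (μ : Measure (MaxID.C0 T))
    (hμ : ∀ ε : ℝ, 0 < ε → μ {f : MaxID.C0 T | ε < ‖f.1‖} < ∞)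
    -- the Poisson random measure and the sample continuous process `η = max(Φ)`
    (Φ : Ω → MaxID.PointMeasure T) (hΦ : MaxID.IsPoissonRandomMeasure Φ μ P)
    (η : Ω → C(T, ℝ)) (hη : ∀ ω s, η ω s = (Φ ω).max s)
    (t : T)
    -- one of the three equivalent regularity conditions at `t`
    (ht : (∀ᵐ ω ∂P, ((Φ ω).extremal {t}).1 univ = 1) ∨
      (Tendsto (MaxID.tail μ t) (𝓝[>] 0) (𝓝 ∞) ∧ ContinuousOn (MaxID.tail μ t) (Ioi 0)) ∨
      (∀ x : ℝ, P {ω | η ω t = x} = 0))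
    -- a regular version `κ y = P_t(y, ·)` of `μ(df)` given `f t = y`
    (κ : Kernel ℝ (MaxID.C0 T)) (hκ : MaxID.IsRegularCondMeasure μ t κ) :
    -- the `t`-extremal function exists
    (∃ φ : Ω → MaxID.C0 T, Measurable φ ∧
      ∀ᵐ ω ∂P, ((Φ ω).extremal {t}).1 = Measure.dirac (φ ω)) ∧
    -- conditional law of the `t`-extremal function and of the sub-extremal point measure
    (∃ R : Kernel ℝ (MaxID.PointMeasure T), IsMarkovKernel R ∧
      (∀ y : ℝ, MaxID.IsPoissonRandomMeasureLaw (R y) (μ.restrict {f | f.1 t < y})) ∧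
      ∀ φ : Ω → MaxID.C0 T, Measurable φ →
        (∀ᵐ ω ∂P, ((Φ ω).extremal {t}).1 = Measure.dirac (φ ω)) →
        MaxID.IsRegularCondDistrib (fun ω => (φ ω, (Φ ω).subExtremal {t})) (fun ω => η ω t) P
          (κ ×ₖ R)) ∧
    -- conditional law of the process
    (∀ᵐ y ∂(P.map (fun ω => η ω t)),
      ∀ (l : ℕ) (s : Fin l → T) (z : Fin l → ℝ), (∀ i, 0 ≤ z i) →
        condDistrib η (fun ω => η ω t) P y {g | ∀ i, g (s i) < z i} =
          κ y {f | ∀ i, f.1 (s i) < z i} *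
            EReal.exp (-((μ {f | (¬ ∀ i, f.1 (s i) < z i) ∧ f.1 t < y} : ℝ≥0∞) : EReal))) := by
  have hreg : MaxID.IsRegularAt μ t := by
    rcases ht with ht | ⟨h0, hc⟩ | ht
    · exact hΦ.isRegularAt_of_ae_extremal hμ ht
    · exact MaxID.isRegularAt_of_tail hμ h0 hc
    · exact hΦ.isRegularAt_of_no_atom hμ (by simpa only [hη] using ht)
  have := hκ.isMarkov
  have hη' : (fun ω => η ω t) = fun ω => (Φ ω).max t := funext fun ω => hη ω t
  have hcond : ∀ φ : Ω → MaxID.C0 T, Measurable φ →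
      (∀ᵐ ω ∂P, ((Φ ω).extremal {t}).1 = Measure.dirac (φ ω)) →
      MaxID.IsRegularCondDistrib (fun ω => (φ ω, (Φ ω).subExtremal {t})) (fun ω => η ω t) P
        (κ ×ₖ MaxID.restrictKernel P hΦ.measurable t) := fun φ hφ hdirac => by
    rw [hη']
    exact hΦ.isRegularCondDistrib_extremal hμ hreg hκ hφ hdirac
  obtain ⟨φ, hφ, hdirac⟩ := hΦ.exists_extremal_function (hΦ.ae_extremal_univ hμ hreg)
  refine ⟨⟨φ, hφ, hdirac⟩, ⟨MaxID.restrictKernel P hΦ.measurable t, inferInstance,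
    hΦ.isPoissonRandomMeasureLaw_restrictKernel t, hcond⟩, ?_⟩
  -- The exceptional null set is where two kernels differ as measures, so it depends on none of `l`,
  -- `s`, `z`.
  filter_upwards [hΦ.condDistrib_max hdirac hη (hcond φ hφ hdirac)] with y hy l s z _
  rw [hy]
  exact hΦ.map_supMax_apply t y s z
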